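/- Let $K:\mathbb R^2\to\mathbb R$ be a continuous, bounded, symmetric kernel (for example the Lieb–Liniger kernel $K(k,k')=-\frac1\pi\frac{c}{c^2+(k-k')^2}$, $c>0$). **Dressing.** For a rapidly decaying function $s$ on $\mathbb R$, let $U=U[s]$ be the dressing operator: $g=Uf$ is the unique continuous, polynomially bounded solution of $g(k)+\int K(k,k')s(k')g(k')\,dk'=f(k)$, for $f$ continuous and polynomially bounded. Put $$\alpha(k,k')=-\int U(k,k'')K(k'',k')\,dk'',\qquad P'=U1,\qquad \rho=\frac{1}{2\pi}P's,$$ $$q^{(0)}=1,\qquad q^{(n)}(k)=\frac{k^n}{n}\ \ (n\ge1),\qquad {Q^{(n)}}'=U{q^{(n)}}',\qquad w^{(n)}=\frac{{Q^{(n+1)}}'}{P'}\ \ (n\ge0).$$ **Phase space.** It consists of the fields $\theta(x,k)$, $(x,k)\in\mathbb R^2$, that are $C^2$ in $x$, with $\partial_x^j\theta$ ($j\le2$) jointly continuous and $\sup_{x,k}(1+x^2)(1+|k|)^N|\partial_x^j\theta|<\infty$ for all $N$, and such that for every $x$ the dressing operator exists in the state $s=\theta(x,\cdot)$ and $P'$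 is bounded below by a positive constant. Below, $U,\alpha,P',\rho,w^{(n)}$ at $x$ are taken in the state $\theta(x,\cdot)$. **Bracket.** For functionals $I,J$ of $\theta$ put $$\{\theta(x,k),J\}=\int dk'\,A(k,k')\frac{\delta J}{\delta\theta(x,k')},\qquad \{I,J\}=\int dx\,dk\,\frac{\delta I}{\delta\theta(x,k)}\{\theta(x,k),J\},$$ $$A(k,k')=\frac{\delta(k-k')}{P'(k)^2}\Big[\frac{d}{dx}-\int dk''\frac{\alpha(k,k'')P'(k'')}{P'(k)}\theta_x(x,k'')\Big]+\frac{\alpha(k,k')}{P'(k)P'(k')}\big(\theta_x(x,k)-\theta_x(x,k')\big)-\frac{\theta_x(x,k)}{P'(k)}\int dk''\,\alpha(k,k'')\,d_x^{-1}\,\alpha(k'',k')\frac{1}{P'(k')}\theta_x(x,k').$$ Here $d_x^{-1}$ is the inverse of $d/dx$. It is fixed up to constants of integration: with $D=\delta J/\delta\theta$, a determination of the non-local term is a function $F(x,k'')$, measurable in $k''$, with $\partial_xF(x,k'')=\int\alpha(k'',k')\frac{\theta_x(x,k')}{P'(k')}D(x,k')\,dk'$ such that $\int|\alpha(k,k')(\frac{D(x,k')}{P'(k')}-F(x,k'))|\,dk'\le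 C(1+|k|)^N$ for some $C,N$ and all $x,k$. The last two terms of $A$, applied to $D$, are collected under a single rapidity integral: $$\int\Big[\frac{\alpha(k,k')}{P'(k)P'(k')}\big(\theta_x(x,k)-\theta_x(x,k')\big)D(x,k')-\frac{\theta_x(x,k)}{P'(k)}\alpha(k,k')F(x,k')\Big]dk'.$$ **Proposition.** For all fields of the phase space the following hold; in particular all the functional derivatives and integrals involved exist. 1. For every $n\ge0$ the functional $$\mathcal Q^{(n)}[\theta]=\int dx\int dk\,\rho(x,k)\,q^{(n)}(k)$$ lies in the kernel of the bracket: there is a choice of the constants of integration (the limits $b(k)$ of $F(x,k)$ as $x\to\pm\infty$, the same at both ends and the same for all fields) with which $\{\theta(x,k),\mathcal Q^{(n)}\}=0$ for all $x,k$. 2. For every $n\ge0$ the functional $$H^{(n)}[\theta]=-\pi\int dx\int dk\,\rho(x,k)\,\theta(x,k)\,{q^{(n+1)}}'(k)$$ generates the flow $\partial_t\theta+w^{(n)}\partial_x\theta=0$: with $F\to0$ as $x\to\pm\infty$, $\{\theta(x,k),H^{(n)}\}=-w^{(n)}(k)\,\theta_x(x,k)$ for all $x,k$. These flows commute: for all $m,n$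 the derivative of the vector field $-w^{(m)}\theta_x$ along $-w^{(n)}\theta_x$ exists at every $(x,k)$ and is symmetric in $m,n$. 3. For all $m,n\ge0$, $$\{\mathcal Q^{(m)},\mathcal Q^{(n)}\}=\{H^{(m)},\mathcal Q^{(n)}\}=\{\mathcal Q^{(n)},H^{(m)}\}=\{H^{(m)},H^{(n)}\}=0,$$ for every determination of the non-local term. -/

import Mathlib

open Filter Topology MeasureTheory

noncomputable section

namespace BetheBoltzmann

/-! ### The integral kernel, dressing and dressed charges -/

/-- A real, continuous, bounded and symmetric integral kernel on rapidity space, such as the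
Lieb-Liniger kernel `K k k' = -(1/π) * c / (c ^ 2 + (k - k') ^ 2)`, `c > 0`. -/
structure IsTBAKernel (K : ℝ → ℝ → ℝ) : Prop where
  continuous : Continuous (fun p : ℝ × ℝ => K p.1 p.2)
  bounded : ∃ C, ∀ k k', |K k k'| ≤ C
  symm : ∀ k k', K k k' = K k' k

/-- Continuous functions of rapidity of at most polynomial growth. -/
def PolyGrowth (f : ℝ → ℝ) : Prop :=
  Continuous f ∧ ∃ (C : ℝ) (N : ℕ), ∀ k, |f k| ≤ C * (1 + |k|) ^ N

/-- `g = U f`, where `U = (1 + K s)⁻¹` is the dressing operator in the local state `s` (a Fermi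
factor `k ↦ s k`):  `g(k) + ∫ K(k,k') s(k') g(k') dk' = f(k)`. -/
def IsDressed (K : ℝ → ℝ → ℝ) (s f g : ℝ → ℝ) : Prop :=
  PolyGrowth g ∧ ∀ k, g k + ∫ k', K k k' * s k' * g k' = f k

/-- The dressing operator exists in the state `s`. -/
def DressingExists (K : ℝ → ℝ → ℝ) (s : ℝ → ℝ) : Prop :=
  ∀ f, PolyGrowth f → ∃! g, IsDressed K s f g

/-- `(U f)(k) = ∫ U(k,k') f(k') dk'`, the solution of the dressing equation. -/
def dress (K : ℝ → ℝ → ℝ) (s f : ℝ → ℝ) : ℝ → ℝ :=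
  Classical.epsilon (IsDressed K s f)

/-- `α(k,k') = - ∫ U(k,k'') K(k'',k') dk''`. -/
def alpha (K : ℝ → ℝ → ℝ) (s : ℝ → ℝ) (k k' : ℝ) : ℝ :=
  -dress K s (fun k'' => K k'' k') k

/-- The derivative of the dressed momentum, `P'(k) = ∫ U(k,k') dk'`. -/
def dP (K : ℝ → ℝ → ℝ) (s : ℝ → ℝ) : ℝ → ℝ :=
  dress K s (fun _ => 1)

/-- The pseudo-momentum density `ρ(k) = ρᵗ(k) s(k)` with `ρᵗ(k) = (1/2π) ∫ U(k,k') dk'`. -/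
def rho (K : ℝ → ℝ → ℝ) (s : ℝ → ℝ) (k : ℝ) : ℝ :=
  1 / (2 * Real.pi) * dP K s k * s k

/-- The bare charges: `q⁽⁰⁾ = 1` (particle number) and `q⁽ⁿ⁾(k) = kⁿ / n` for `n ≥ 1`. -/
def charge (n : ℕ) (k : ℝ) : ℝ :=
  if n = 0 then 1 else k ^ n / n

/-- The derivative `Q⁽ⁿ⁾'` of the dressed charge, obtained by dressing `q⁽ⁿ⁾'`. -/
def dQ (K : ℝ → ℝ → ℝ) (n : ℕ) (s : ℝ → ℝ) : ℝ → ℝ :=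
  dress K s (deriv (charge n))

/-! ### Fields -/

/-- `∂ₓ θ(x,k)`. -/
def dx (θ : ℝ → ℝ → ℝ) (x k : ℝ) : ℝ :=
  deriv (fun y => θ y k) x

/-- Fields `θ(x,k)` that are twice continuously differentiable in `x` and that decay, with these
derivatives, like `1 / (1 + x²)` in position and faster than any power in rapidity. -/
structure IsField (θ : ℝ → ℝ → ℝ) : Prop where
  contDiff : ∀ k, ContDiff ℝ 2 (fun x => θ x k)
  continuous : ∀ j ≤ 2,
    Continuous (fun p : ℝ × ℝ => iteratedDeriv j (fun y => θ y p.2) p.1)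
  decay : ∀ j ≤ 2, ∀ N : ℕ, ∃ C, ∀ x k,
    (1 + x ^ 2) * (1 + |k|) ^ N * |iteratedDeriv j (fun y => θ y k) x| ≤ C

/-- Local states in which the dressing operator exists and `P'` is positive, bounded away
from zero. -/
def IsRegular (K : ℝ → ℝ → ℝ) (s : ℝ → ℝ) : Prop :=
  DressingExists K s ∧ ∃ δ > 0, ∀ k, δ ≤ dP K s k

/-- The phase space: fields all of whose local states are regular. -/
def IsPhasePoint (K : ℝ → ℝ → ℝ) (θ : ℝ → ℝ → ℝ) : Prop :=
  IsField θ ∧ ∀ x, IsRegular K (θ x)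

/-! ### Functionals and the bracket -/

/-- `D(x,k) = δI/δθ(x,k)` at the field `θ`. By continuity, `D` is uniquely determined. -/
def HasFunctionalDeriv (I : (ℝ → ℝ → ℝ) → ℝ) (θ D : ℝ → ℝ → ℝ) : Prop :=
  Continuous (fun p : ℝ × ℝ => D p.1 p.2) ∧
  ∀ η : ℝ → ℝ → ℝ,
    ContDiff ℝ (⊤ : ℕ∞) (fun p : ℝ × ℝ => η p.1 p.2) →
    HasCompactSupport (fun p : ℝ × ℝ => η p.1 p.2) →
    HasDerivAt (fun ε : ℝ => I (fun x k => θ x k + ε * η x k))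
      (∫ p : ℝ × ℝ, D p.1 p.2 * η p.1 p.2) 0

/-- `F` is a determination of `dₓ⁻¹ ∫ α(k'',k') (1/P'(k')) θₓ(x,k') D(x,k') dk'`, as a function of
`(x,k'')`, where `D = δJ/δθ`, and all terms of the bracket with `J` are well defined: `dₓ⁻¹` is the
inverse of `d/dx`, hence fixed up to an `x`-independent constant of integration. The integrals
over rapidity converge absolutely, and the one that involves `F` does so with a bound that is
uniform in `x` and polynomial in `k`. -/
structure IsDetermination (K : ℝ → ℝ → ℝ) (θ D F : ℝ → ℝ → ℝ) : Prop where
  differentiable : ∀ x k, DifferentiableAt ℝ (fun y => D y k) x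
  measurable : ∀ x, Measurable (F x)
  integrable_local : ∀ x k,
    Integrable (fun k'' => alpha K (θ x) k k'' * dP K (θ x) k'' / dP K (θ x) k * dx θ x k'')
  integrable : ∀ x k,
    Integrable (fun k' => alpha K (θ x) k k' * (1 / dP K (θ x) k') * dx θ x k' * D x k')
  hasDerivAt : ∀ x k,
    HasDerivAt (fun y => F y k)
      (∫ k', alpha K (θ x) k k' * (1 / dP K (θ x) k') * dx θ x k' * D x k') x
  convergent : ∃ (C : ℝ) (N : ℕ), ∀ x k,
    Integrable (fun k' => alpha K (θ x) k k' * (D x k' / dP K (θ x) k' - F x k')) ∧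
    ∫ k', |alpha K (θ x) k k' * (D x k' / dP K (θ x) k' - F x k')| ≤ C * (1 + |k|) ^ N

/-- `{θ(x,k), J} = ∫ A(k,k') δJ/δθ(x,k') dk'`, where `D = δJ/δθ` and `F` is the determination of
the non-local term. The last two terms of `A` are collected under one rapidity integral, since
for kernels that do not decay fast each of them alone may diverge. -/
def bracketField (K : ℝ → ℝ → ℝ) (θ D F : ℝ → ℝ → ℝ) (x k : ℝ) : ℝ :=
  1 / dP K (θ x) k ^ 2 *
    (dx D x k -
      (∫ k'', alpha K (θ x) k k'' * dP K (θ x) k'' / dP K (θ x) k * dx θ x k'') * D x k) +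
  ∫ k', (alpha K (θ x) k k' / (dP K (θ x) k * dP K (θ x) k') * (dx θ x k - dx θ x k') * D x k' -
    dx θ x k / dP K (θ x) k * (alpha K (θ x) k k' * F x k'))

/-- The functional `J` generates the evolution `∂ₜ θ = {θ, J} = X[θ]` on phase space, where the
constant of integration in `dₓ⁻¹` is the same for all fields: `b` is the value of the non-local
term at the point at infinity of the compactified real line. This makes the determination `F`
unique; `b = 0` is the choice `dₓ⁻¹ = ∫_{-∞}^x`. -/
def Generates (K : ℝ → ℝ → ℝ) (b : ℝ → ℝ) (J : (ℝ → ℝ → ℝ) → ℝ)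
    (X : (ℝ → ℝ → ℝ) → ℝ → ℝ → ℝ) : Prop :=
  ∀ θ, IsPhasePoint K θ →
    ∃ D F, HasFunctionalDeriv J θ D ∧ IsDetermination K θ D F ∧
      (∀ k, Tendsto (fun x => F x k) (cocompact ℝ) (𝓝 (b k))) ∧
      ∀ x k, bracketField K θ D F x k = X θ x k

/-- `J` lies in the kernel of the bracket: `{θ(x,k), J} = 0` identically, for one choice of the
constants of integration. -/
def IsCasimir (K : ℝ → ℝ → ℝ) (J : (ℝ → ℝ → ℝ) → ℝ) : Prop :=
  ∃ b, Generates K b J (fun _ _ _ => 0)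

/-- `{I, J} = r` at `θ`: the bracket is defined, and it has this value for every determination of
the non-local term. -/
def HasBracket (K : ℝ → ℝ → ℝ) (I J : (ℝ → ℝ → ℝ) → ℝ) (θ : ℝ → ℝ → ℝ) (r : ℝ) : Prop :=
  (∃ DI DJ F, HasFunctionalDeriv I θ DI ∧ HasFunctionalDeriv J θ DJ ∧
    IsDetermination K θ DJ F) ∧
  ∀ DI DJ F, HasFunctionalDeriv I θ DI → HasFunctionalDeriv J θ DJ →
    IsDetermination K θ DJ F →
    Integrable (fun p : ℝ × ℝ => DI p.1 p.2 * bracketField K θ DJ F p.1 p.2) ∧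
    ∫ p : ℝ × ℝ, DI p.1 p.2 * bracketField K θ DJ F p.1 p.2 = r

/-! ### Charges, Hamiltonians and flows -/

/-- `𝒬⁽ⁿ⁾[θ] = ∫ dx ∫ dk ρ(x,k) q⁽ⁿ⁾(k)`. -/
def casimirQ (K : ℝ → ℝ → ℝ) (n : ℕ) (θ : ℝ → ℝ → ℝ) : ℝ :=
  ∫ x, ∫ k, rho K (θ x) k * charge n k

/-- `H⁽ⁿ⁾[θ] = -π ∫ dx ∫ dk ρ(x,k) θ(x,k) q⁽ⁿ⁺¹⁾'(k)`. -/
def hamiltonianH (K : ℝ → ℝ → ℝ) (n : ℕ) (θ : ℝ → ℝ → ℝ) : ℝ :=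
  -Real.pi * ∫ x, ∫ k, rho K (θ x) k * θ x k * deriv (charge (n + 1)) k

/-- The velocities `w⁽ⁿ⁾(k) = Q⁽ⁿ⁺¹⁾'(k) / P'(k)`. -/
def velocity (K : ℝ → ℝ → ℝ) (n : ℕ) (s : ℝ → ℝ) (k : ℝ) : ℝ :=
  dQ K (n + 1) s k / dP K s k

/-- The vector field of the flow `∂ₜ θ + w⁽ⁿ⁾[θ] ∂ₓ θ = 0`. -/
def flow (K : ℝ → ℝ → ℝ) (n : ℕ) (θ : ℝ → ℝ → ℝ) (x k : ℝ) : ℝ :=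
  -(velocity K n (θ x) k * dx θ x k)

/-- The vector fields `X`, `Y` on fields commute at `θ`: the derivative of `X` along `Y` equals
that of `Y` along `X`. -/
def CommuteAt (X Y : (ℝ → ℝ → ℝ) → ℝ → ℝ → ℝ) (θ : ℝ → ℝ → ℝ) : Prop :=
  ∀ x k, ∃ L : ℝ,
    HasDerivAt (fun ε : ℝ => X (fun y l => θ y l + ε * Y θ y l) x k) L 0 ∧
    HasDerivAt (fun ε : ℝ => Y (fun y l => θ y l + ε * X θ y l) x k) L 0

end BetheBoltzmann

end

/-! Write `α` for the integral operator with kernel `alpha` in the state `θ(x,·)`. Everything rests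
on the resolvent identity `U[s'] f = U[s] f + α[s] (s' - s) U[s'] f` (`IsDressed.eq_dress_add`) and
on the symmetry of `α` (`alpha_symm`). To first order the identity says that a variation `δθ`
changes `U f` by `α δθ U f`; hence `∂ₓ (U f) = α θₓ U f`, and likewise `∂ₓ (α G) = α θₓ α G + α Gₓ`.

Charges and Hamiltonians are both instances of one functional, `energy = ∫∫ P' (a θ + c θ²) q`: `a =
1/(2π)`, `c = 0` for the charges, `a = 0`, `c = -1/2` for the Hamiltonians. Moving `α` across the
integral by symmetry gives its functional derivative as `D = P' G` with `G = F + 2c θ q` and `F = α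
(a θ + c θ²) q + a q`. Since `∂ₓ F = α θₓ G` and `θₓ D / P' = θₓ G`, this explicit `F` (`potential`)
is itself a determination of the non-local term, and it tends to `a q` at both ends. In the bracket
(`bracketField_variation`) the terms with `α θₓ P'` and `α θₓ G` cancel, and what is left is `(θₓ /
P') 2c (q + α θ q) = 2c (θₓ / P') U q`. It vanishes for `c = 0` and is the flow for `c = -1/2`.

Any other determination is `F + b` with `b` independent of `x`; this adds `-(θₓ / P') α b` to the
bracket. The bracket of two functionals is therefore a multiple of `∫∫ θₓ G U r` minus `∫∫ θₓ G α
b`. Both vanish as integrals of `x`-derivatives: `∫ θₓ G U r dk = ∂ₓ ∫ (a θ + c θ²) q U r dk`, and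
`∫ θₓ G α(k,l) dk = ∂ₓ F(x,l)`, where `F` has equal limits at the two ends. The flows commute
because the derivative of one along the other, once written out, is symmetric in the two bare
functions (`hasDerivAt_flow`).

The analytic work is to make these identities legitimate. Boundedness of `α` comes from the open
mapping theorem in one state (`exists_bound_alpha`), and from perturbation and compactness uniformly
in `x` (`exists_uniform_bound_alpha`). The remainders are quadratic by `abs_le_of_small`. -/

noncomputable section

namespace BetheBoltzmann

/-! ### Bounded kernels and rapidly decaying functions -/

/-- Continuous kernels bounded by `M`. -/
structure BddKer (a : ℝ → ℝ → ℝ) (M : ℝ) : Prop where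
  continuous : Continuous (fun p : ℝ × ℝ => a p.1 p.2)
  bound : ∀ k k', |a k k'| ≤ M

/-- The integral operator with kernel `a`. -/
def kint (a : ℝ → ℝ → ℝ) (h : ℝ → ℝ) (k : ℝ) : ℝ :=
  ∫ k', a k k' * h k'

/-- Continuous functions decaying faster than any power. -/
def Rapid (s : ℝ → ℝ) : Prop :=
  Continuous s ∧ ∀ N : ℕ, ∃ C, ∀ k, (1 + |k|) ^ N * |s k| ≤ C

lemma one_le_one_add_abs_pow (k : ℝ) (N : ℕ) : 1 ≤ (1 + |k|) ^ N :=
  one_le_pow₀ (by linarith [abs_nonneg k])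

lemma one_add_sq_le (k : ℝ) : 1 + k ^ 2 ≤ (1 + |k|) ^ 2 := by
  nlinarith [abs_nonneg k, sq_abs k]

lemma abs_le_inv_one_add_sq {y C k : ℝ} (h : (1 + |k|) ^ 2 * |y| ≤ C) :
    |y| ≤ C * (1 + k ^ 2)⁻¹ := by
  rw [← div_eq_mul_inv, le_div_iff₀ (by positivity)]
  nlinarith [one_add_sq_le k, abs_nonneg y]

lemma BddKer.nonneg {a : ℝ → ℝ → ℝ} {M : ℝ} (ha : BddKer a M) : 0 ≤ M :=
  (abs_nonneg _).trans (ha.bound 0 0)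

lemma BddKer.swap {a : ℝ → ℝ → ℝ} {M : ℝ} (ha : BddKer a M) : BddKer (fun k k' => a k' k) M :=
  ⟨ha.continuous.comp continuous_swap, fun k k' => ha.bound k' k⟩

lemma BddKer.continuous_right {a : ℝ → ℝ → ℝ} {M : ℝ} (ha : BddKer a M) (k : ℝ) :
    Continuous (a k) :=
  ha.continuous.comp (Continuous.prodMk_right k)

lemma BddKer.integrable_mul {a : ℝ → ℝ → ℝ} {M : ℝ} (ha : BddKer a M) {h : ℝ → ℝ}
    (hh : Integrable h) (k : ℝ) : Integrable (fun k' => a k k' * h k') :=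
  hh.bdd_mul (ha.continuous_right k).aestronglyMeasurable (ae_of_all _ (ha.bound k))

lemma abs_kint_le {a : ℝ → ℝ → ℝ} {M : ℝ} (ha : BddKer a M) {h : ℝ → ℝ} (hh : Integrable h)
    (k : ℝ) : |kint a h k| ≤ M * ∫ k', |h k'| := by
  rw [kint, ← integral_const_mul, ← Real.norm_eq_abs]
  refine norm_integral_le_of_norm_le (hh.abs.const_mul M) (ae_of_all _ fun k' => ?_)
  rw [Real.norm_eq_abs, abs_mul]
  exact mul_le_mul_of_nonneg_right (ha.bound k k') (abs_nonneg _)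

lemma continuous_kint {a : ℝ → ℝ → ℝ} {M : ℝ} (ha : BddKer a M) {h : ℝ → ℝ}
    (hh : Integrable h) : Continuous (kint a h) := by
  refine continuous_of_dominated (bound := fun k' => M * |h k'|)
    (fun k => (ha.integrable_mul hh k).1) (fun k => ae_of_all _ fun k' => ?_)
    (hh.abs.const_mul M) (ae_of_all _ fun k' => ?_)
  · rw [Real.norm_eq_abs, abs_mul]
    exact mul_le_mul_of_nonneg_right (ha.bound k k') (abs_nonneg _)
  · exact (ha.swap.continuous_right k').mul continuous_const

lemma polyGrowth_of_bounded {f : ℝ → ℝ} (hf : Continuous f) {C : ℝ} (h : ∀ k, |f k| ≤ C) :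
    PolyGrowth f :=
  ⟨hf, C, 0, fun k => by simpa using h k⟩

lemma polyGrowth_kint {a : ℝ → ℝ → ℝ} {M : ℝ} (ha : BddKer a M) {h : ℝ → ℝ}
    (hh : Integrable h) : PolyGrowth (kint a h) :=
  polyGrowth_of_bounded (continuous_kint ha hh) (abs_kint_le ha hh)

lemma kint_add {a : ℝ → ℝ → ℝ} {M : ℝ} (ha : BddKer a M) {g h : ℝ → ℝ} (hg : Integrable g)
    (hh : Integrable h) (k : ℝ) : kint a (fun l => g l + h l) k = kint a g k + kint a h k := by
  simp only [kint, mul_add]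
  exact integral_add (ha.integrable_mul hg k) (ha.integrable_mul hh k)

lemma kint_sub {a : ℝ → ℝ → ℝ} {M : ℝ} (ha : BddKer a M) {g h : ℝ → ℝ} (hg : Integrable g)
    (hh : Integrable h) (k : ℝ) : kint a (fun l => g l - h l) k = kint a g k - kint a h k := by
  simp only [kint, mul_sub]
  exact integral_sub (ha.integrable_mul hg k) (ha.integrable_mul hh k)

lemma kint_const_mul (a : ℝ → ℝ → ℝ) (h : ℝ → ℝ) (c k : ℝ) :
    kint a (fun l => c * h l) k = c * kint a h k := by
  simp only [kint, ← integral_const_mul]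
  congr 1; ext; ring

/-- Fubini's theorem for a bounded kernel. -/
lemma integral_mul_kint {a : ℝ → ℝ → ℝ} {M : ℝ} (ha : BddKer a M) {g h : ℝ → ℝ}
    (hg : Integrable g) (hh : Integrable h) :
    ∫ k, g k * kint a h k = ∫ k', h k' * kint (fun k k' => a k' k) g k' := by
  have hint : Integrable (Function.uncurry fun k k' => g k * (a k k' * h k'))
      (volume.prod volume) := by
    have := (hg.mul_prod hh).bdd_mul (c := M) ha.continuous.aestronglyMeasurable
      (ae_of_all _ fun p => ha.bound p.1 p.2)
    refine this.congr (ae_of_all _ fun p => ?_)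
    simp only [Function.uncurry]; ring
  simp only [kint, ← integral_const_mul]
  rw [integral_integral_swap hint]
  congr 1; ext k'; congr 1; ext k; ring

lemma kint_kint {a b : ℝ → ℝ → ℝ} {M M' : ℝ} (ha : BddKer a M) (hb : BddKer b M')
    {g h : ℝ → ℝ} (hg : Integrable g) (hh : Integrable h) (k : ℝ) :
    kint a (fun l => g l * kint b h l) k =
      ∫ k', h k' * ∫ l, a k l * (g l * b l k') := by
  have := integral_mul_kint hb (ha.integrable_mul hg k) hh
  simp only [kint] at this ⊢
  calc _ = ∫ l, a k l * g l * ∫ k', b l k' * h k' := by congr 1; ext; ring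
    _ = _ := by
      rw [this]; congr 1; ext k'; congr 2; ext l; ring

lemma PolyGrowth.add {f g : ℝ → ℝ} (hf : PolyGrowth f) (hg : PolyGrowth g) :
    PolyGrowth (fun k => f k + g k) := by
  obtain ⟨hf, C, N, hC⟩ := hf
  obtain ⟨hg, C', N', hC'⟩ := hg
  refine ⟨hf.add hg, |C| + |C'|, N + N', fun k => (abs_add_le _ _).trans ?_⟩
  have h1 := hC k
  have h2 := hC' k
  have e1 := one_le_one_add_abs_pow k N
  have e2 := one_le_one_add_abs_pow k N'
  rw [pow_add, add_mul]
  refine add_le_add (h1.trans ?_) (h2.trans ?_)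
  · calc C * (1 + |k|) ^ N ≤ |C| * (1 + |k|) ^ N := by gcongr; exact le_abs_self C
      _ ≤ _ := by gcongr; nlinarith
  · calc C' * (1 + |k|) ^ N' ≤ |C'| * (1 + |k|) ^ N' := by gcongr; exact le_abs_self C'
      _ ≤ _ := by gcongr; nlinarith

lemma PolyGrowth.mul {f g : ℝ → ℝ} (hf : PolyGrowth f) (hg : PolyGrowth g) :
    PolyGrowth (fun k => f k * g k) := by
  obtain ⟨hf, C, N, hC⟩ := hf
  obtain ⟨hg, C', N', hC'⟩ := hg
  refine ⟨hf.mul hg, C * C', N + N', fun k => ?_⟩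
  rw [abs_mul, pow_add]
  calc |f k| * |g k| ≤ (C * (1 + |k|) ^ N) * (C' * (1 + |k|) ^ N') :=
        mul_le_mul (hC k) (hC' k) (abs_nonneg _) ((abs_nonneg _).trans (hC k))
    _ = _ := by ring

lemma PolyGrowth.const (c : ℝ) : PolyGrowth (fun _ => c) :=
  polyGrowth_of_bounded continuous_const (fun _ => le_rfl)

lemma PolyGrowth.sub {f g : ℝ → ℝ} (hf : PolyGrowth f) (hg : PolyGrowth g) :
    PolyGrowth (fun k => f k - g k) := by
  simpa [sub_eq_add_neg] using hf.add ((PolyGrowth.const (-1)).mul hg)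

lemma Rapid.mul_poly {s f : ℝ → ℝ} (hs : Rapid s) (hf : PolyGrowth f) :
    Rapid (fun k => s k * f k) := by
  obtain ⟨hf, C, N, hC⟩ := hf
  refine ⟨hs.1.mul hf, fun n => ?_⟩
  obtain ⟨C', hC'⟩ := hs.2 (n + N)
  refine ⟨C' * |C|, fun k => ?_⟩
  have h1 := hC' k
  have h2 : |f k| ≤ |C| * (1 + |k|) ^ N := (hC k).trans (by gcongr; exact le_abs_self C)
  rw [abs_mul]
  calc (1 + |k|) ^ n * (|s k| * |f k|)
      ≤ (1 + |k|) ^ n * (|s k| * (|C| * (1 + |k|) ^ N)) := by gcongr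
    _ = ((1 + |k|) ^ (n + N) * |s k|) * |C| := by ring
    _ ≤ C' * |C| := by gcongr

lemma Rapid.poly_mul {s f : ℝ → ℝ} (hs : Rapid s) (hf : PolyGrowth f) :
    Rapid (fun k => f k * s k) := by
  simpa only [mul_comm] using hs.mul_poly hf

lemma Rapid.integrable {s : ℝ → ℝ} (hs : Rapid s) : Integrable s := by
  obtain ⟨C, hC⟩ := hs.2 2
  exact (integrable_inv_one_add_sq.const_mul C).mono' hs.1.aestronglyMeasurable
    (ae_of_all _ fun k => abs_le_inv_one_add_sq (hC k))

lemma Rapid.add {s t : ℝ → ℝ} (hs : Rapid s) (ht : Rapid t) : Rapid (fun k => s k + t k) := by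
  refine ⟨hs.1.add ht.1, fun N => ?_⟩
  obtain ⟨C, hC⟩ := hs.2 N
  obtain ⟨C', hC'⟩ := ht.2 N
  refine ⟨C + C', fun k => ?_⟩
  calc _ ≤ (1 + |k|) ^ N * (|s k| + |t k|) := by gcongr; exact abs_add_le _ _
    _ ≤ C + C' := by linarith [hC k, hC' k]

lemma Rapid.const_mul {s : ℝ → ℝ} (hs : Rapid s) (c : ℝ) : Rapid (fun k => c * s k) :=
  hs.poly_mul (PolyGrowth.const c)

lemma Rapid.sub {s t : ℝ → ℝ} (hs : Rapid s) (ht : Rapid t) : Rapid (fun k => s k - t k) := by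
  simpa [sub_eq_add_neg] using hs.add (ht.const_mul (-1))

lemma integrable_mul_bcf {h : ℝ → ℝ} (hh : Integrable h) (g : BoundedContinuousFunction ℝ ℝ) :
    Integrable (fun k => h k * g k) :=
  hh.mul_bdd g.continuous.aestronglyMeasurable (ae_of_all _ g.norm_coe_le_norm)

/-- The integral operator `g ↦ ∫ a(·,k') h(k') g(k') dk'` on bounded continuous functions. -/
def kernelOp {a : ℝ → ℝ → ℝ} {M : ℝ} (ha : BddKer a M) {h : ℝ → ℝ} (hh : Integrable h) :
    BoundedContinuousFunction ℝ ℝ →L[ℝ] BoundedContinuousFunction ℝ ℝ :=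
  LinearMap.mkContinuous
    { toFun := fun g => BoundedContinuousFunction.ofNormedAddCommGroup
        (kint a (fun k => h k * g k)) (continuous_kint ha (integrable_mul_bcf hh g)) _ (abs_kint_le ha (integrable_mul_bcf hh g))
      map_add' := fun f g => by
        ext k
        have := kint_add ha (integrable_mul_bcf hh f) (integrable_mul_bcf hh g) k
        simpa [mul_add] using this
      map_smul' := fun c g => by
        ext k
        have := kint_const_mul a (fun k => h k * g k) c k
        simpa [mul_left_comm] using this }
    (M * ∫ k, |h k|) (fun g => by
      have hM := ha.nonneg
      have h0 : 0 ≤ (M * ∫ k, |h k|) * ‖g‖ := by positivity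
      refine (BoundedContinuousFunction.norm_le h0).2 fun k => ?_
      refine (abs_kint_le ha (integrable_mul_bcf hh g) k).trans ?_
      rw [mul_assoc, ← integral_mul_const]
      refine mul_le_mul_of_nonneg_left (integral_mono (integrable_mul_bcf hh g).abs (hh.abs.mul_const _)
        fun l => ?_) hM
      simp only [abs_mul]
      exact mul_le_mul_of_nonneg_left (g.norm_coe_le_norm l) (abs_nonneg _))

lemma kernelOp_apply {a : ℝ → ℝ → ℝ} {M : ℝ} (ha : BddKer a M) {h : ℝ → ℝ} (hh : Integrable h)
    (g : BoundedContinuousFunction ℝ ℝ) (k : ℝ) :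
    kernelOp ha hh g k = kint a (fun k => h k * g k) k :=
  rfl

lemma norm_kernelOp_le {a : ℝ → ℝ → ℝ} {M : ℝ} (ha : BddKer a M) {h : ℝ → ℝ}
    (hh : Integrable h) : ‖kernelOp ha hh‖ ≤ M * ∫ k, |h k| :=
  LinearMap.mkContinuous_norm_le _ (mul_nonneg ha.nonneg (by positivity)) _

/-! ### Dressing in one local state -/

lemma IsTBAKernel.bddKer {K : ℝ → ℝ → ℝ} (hK : IsTBAKernel K) : ∃ C, BddKer K C :=
  hK.bounded.imp fun _ h => ⟨hK.continuous, h⟩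

lemma IsTBAKernel.swap_eq {K : ℝ → ℝ → ℝ} (hK : IsTBAKernel K) : (fun k k' => K k' k) = K := by
  ext k k'; exact hK.symm _ _

lemma IsTBAKernel.polyGrowth_left {K : ℝ → ℝ → ℝ} (hK : IsTBAKernel K) (k' : ℝ) :
    PolyGrowth (fun k => K k k') := by
  obtain ⟨C, hC⟩ := hK.bddKer
  exact polyGrowth_of_bounded (hC.swap.continuous_right k') (fun k => hC.bound k k')

lemma isDressed_iff {K : ℝ → ℝ → ℝ} {s f g : ℝ → ℝ} : IsDressed K s f g ↔
    PolyGrowth g ∧ ∀ k, g k + kint K (fun l => s l * g l) k = f k := by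
  simp only [IsDressed, kint, mul_assoc]

lemma isDressed_dress {K : ℝ → ℝ → ℝ} {s f : ℝ → ℝ} (hs : DressingExists K s)
    (hf : PolyGrowth f) : IsDressed K s f (dress K s f) :=
  Classical.epsilon_spec (hs f hf).exists

lemma polyGrowth_dress {K : ℝ → ℝ → ℝ} {s f : ℝ → ℝ} (hs : DressingExists K s)
    (hf : PolyGrowth f) : PolyGrowth (dress K s f) :=
  (isDressed_dress hs hf).1

lemma dress_add_kint {K : ℝ → ℝ → ℝ} {s f : ℝ → ℝ} (hs : DressingExists K s)
    (hf : PolyGrowth f) (k : ℝ) :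
    dress K s f k + kint K (fun l => s l * dress K s f l) k = f k :=
  (isDressed_iff.1 (isDressed_dress hs hf)).2 k

lemma IsDressed.eq_dress {K : ℝ → ℝ → ℝ} {s f g : ℝ → ℝ} (hs : DressingExists K s)
    (hf : PolyGrowth f) (hg : IsDressed K s f g) : g = dress K s f :=
  (hs f hf).unique hg (isDressed_dress hs hf)

lemma polyGrowth_alpha_left {K : ℝ → ℝ → ℝ} {s : ℝ → ℝ} (hK : IsTBAKernel K)
    (hs : DressingExists K s) (k' : ℝ) : PolyGrowth (fun k => alpha K s k k') := by
  simpa [alpha] using (PolyGrowth.const (-1)).mul (polyGrowth_dress hs (hK.polyGrowth_left k'))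

/-- The dressing equation of the column `K(·,k')`, up to sign. Later arguments use `α` only through
this equation and its operator form `K s α = -K - α`. -/
lemma kint_mul_alpha {K : ℝ → ℝ → ℝ} {s : ℝ → ℝ} (hK : IsTBAKernel K)
    (hs : DressingExists K s) (k k' : ℝ) :
    kint K (fun l => s l * alpha K s l k') k = -K k k' - alpha K s k k' := by
  have h := dress_add_kint hs (hK.polyGrowth_left k') k
  have h2 := kint_const_mul K (fun l => s l * dress K s (fun k => K k k') l) (-1) k
  have h3 : kint K (fun l => s l * alpha K s l k') k =
      kint K (fun l => -1 * (s l * dress K s (fun k => K k k') l)) k := by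
    congr 1; ext l; simp only [alpha]; ring
  rw [h3, h2]
  simp only [alpha]
  linarith

/-- With `αᵢ = α(·,kᵢ)`, symmetry of `K` gives `∫ s α₂ K(s α₁) = ∫ s α₁ K(s α₂)`. Substituting `K(s
αᵢ) = -K(·,kᵢ) - αᵢ`, the terms `s α₁ α₂` cancel. The remaining integrals are `K(s α₂)(k₁)` and `K(s
α₁)(k₂)`, to which the same equation applies once more. -/
lemma alpha_symm {K : ℝ → ℝ → ℝ} {s : ℝ → ℝ} (hK : IsTBAKernel K) (hr : Rapid s)
    (hs : DressingExists K s) (k₁ k₂ : ℝ) : alpha K s k₁ k₂ = alpha K s k₂ k₁ := by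
  obtain ⟨C, hC⟩ := hK.bddKer
  have h1 := hr.mul_poly (polyGrowth_alpha_left hK hs k₁)
  have h2 := hr.mul_poly (polyGrowth_alpha_left hK hs k₂)
  have h12 := h1.mul_poly (polyGrowth_alpha_left hK hs k₂)
  have h21 := h2.mul_poly (polyGrowth_alpha_left hK hs k₁)
  have e := integral_mul_kint hC h2.integrable h1.integrable
  rw [hK.swap_eq] at e
  simp only [kint_mul_alpha hK hs, mul_sub] at e
  rw [integral_sub _ h21.integrable, integral_sub _ h12.integrable] at e
  · have e1 : kint K (fun l => s l * alpha K s l k₂) k₁ =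
        -∫ l, s l * alpha K s l k₂ * -K l k₁ := by
      rw [kint, ← integral_neg]; congr 1; ext l; rw [hK.symm k₁]; ring
    have e2 : kint K (fun l => s l * alpha K s l k₁) k₂ =
        -∫ l, s l * alpha K s l k₁ * -K l k₂ := by
      rw [kint, ← integral_neg]; congr 1; ext l; rw [hK.symm k₂]; ring
    have e3 : ∫ l, s l * alpha K s l k₂ * alpha K s l k₁ =
        ∫ l, s l * alpha K s l k₁ * alpha K s l k₂ := by
      congr 1; ext; ring
    rw [kint_mul_alpha hK hs] at e1 e2
    linarith [hK.symm k₁ k₂]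
  · simpa using (h1.mul_poly (hK.polyGrowth_left k₂)).integrable.neg
  · simpa using (h2.mul_poly (hK.polyGrowth_left k₁)).integrable.neg

/-- Each column of `α` is continuous by construction, hence by symmetry each row. Joint continuity
then follows from `α = -K - K s α` by dominated convergence, for which the bound `M` is needed. -/
lemma bddKer_alpha_of_bound {K : ℝ → ℝ → ℝ} {s : ℝ → ℝ} (hK : IsTBAKernel K) (hr : Rapid s)
    (hs : DressingExists K s) {M : ℝ} (hM : ∀ k k', |alpha K s k k'| ≤ M) :
    BddKer (alpha K s) M := by
  refine ⟨?_, hM⟩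
  obtain ⟨C, hC⟩ := hK.bddKer
  have e : (fun p : ℝ × ℝ => alpha K s p.1 p.2) = fun p =>
      -K p.1 p.2 - ∫ l, K p.1 l * (s l * alpha K s l p.2) := by
    ext p
    have := kint_mul_alpha hK hs p.1 p.2
    rw [kint] at this
    linarith
  rw [e]
  refine hC.continuous.neg.sub ?_
  have hM0 : 0 ≤ M := (abs_nonneg _).trans (hM 0 0)
  refine continuous_of_dominated (bound := fun l => C * (|s l| * M))
    (fun p => (hC.integrable_mul (hr.mul_poly (polyGrowth_alpha_left hK hs p.2)).integrable _).1)
    (fun p => ae_of_all _ fun l => ?_) ((hr.integrable.abs.mul_const M).const_mul C)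
    (ae_of_all _ fun l => ?_)
  · rw [Real.norm_eq_abs, abs_mul, abs_mul]
    have := hC.nonneg
    gcongr
    exacts [hC.bound _ _, hM _ _]
  · refine ((hC.swap.continuous_right l).comp continuous_fst).mul (continuous_const.mul ?_)
    simp only [alpha_symm hK hr hs l]
    exact (polyGrowth_alpha_left hK hs l).1.comp continuous_snd

lemma exists_bcf {f : ℝ → ℝ} (hf : Continuous f) {C : ℝ} (h : ∀ k, |f k| ≤ C) :
    ∃ g : BoundedContinuousFunction ℝ ℝ, (∀ k, g k = f k) ∧ ‖g‖ ≤ C :=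
  ⟨BoundedContinuousFunction.ofNormedAddCommGroup f hf C h, fun _ => rfl,
    BoundedContinuousFunction.norm_ofNormedAddCommGroup_le hf ((abs_nonneg _).trans (h 0)) h⟩

lemma polyGrowth_bcf (g : BoundedContinuousFunction ℝ ℝ) : PolyGrowth g :=
  polyGrowth_of_bounded g.continuous g.norm_coe_le_norm

/-- By the open mapping theorem the resolvent kernel is bounded. -/
lemma exists_bound_alpha {K : ℝ → ℝ → ℝ} {s : ℝ → ℝ} (hK : IsTBAKernel K) (hr : Rapid s)
    (hs : DressingExists K s) : ∃ M > 0, BddKer (alpha K s) M := by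
  obtain ⟨C, hC⟩ := hK.bddKer
  set A := 1 + kernelOp hC hr.integrable with hA
  have hA' : ∀ g k, A g k = g k + kint K (fun l => s l * g l) k := fun g k => rfl
  have hd : ∀ g : BoundedContinuousFunction ℝ ℝ, IsDressed K s (A g) g := fun g =>
    isDressed_iff.2 ⟨polyGrowth_bcf g, fun k => (hA' g k).symm⟩
  have hinj : Function.Injective A := fun g g' h =>
    DFunLike.coe_injective ((hs _ (polyGrowth_bcf (A g))).unique (hd g) (h ▸ hd g'))
  have hdiff : ∀ f : ℝ → ℝ, PolyGrowth f → ∀ k,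
      dress K s f k = f k - kint K (fun l => s l * dress K s f l) k := fun f hf k => by
    linarith [dress_add_kint hs hf k]
  -- A solution of polynomial growth with bounded source is bounded, because `g = f - K (s g)` and
  -- `s g` is integrable. Solvability among polynomially bounded functions thus makes `1 + K s`
  -- bijective on bounded continuous functions.
  have hlift : ∀ (f : ℝ → ℝ) (B : ℝ), Continuous f → (∀ k, |f k| ≤ B) →
      ∃ g : BoundedContinuousFunction ℝ ℝ, ∀ k, g k = dress K s f k := fun f B hf hB => by
    have hp := polyGrowth_of_bounded hf hB
    have hd := (hr.mul_poly (polyGrowth_dress hs hp)).integrable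
    obtain ⟨g, hg, -⟩ := exists_bcf (polyGrowth_dress hs hp).1
      (C := B + C * ∫ l, |s l * dress K s f l|) (fun k => by
        rw [hdiff f hp k]
        exact (abs_sub _ _).trans (add_le_add (hB k) (abs_kint_le hC hd k)))
    exact ⟨g, hg⟩
  have hsurj : Function.Surjective A := fun f => by
    obtain ⟨g, hg⟩ := hlift f _ f.continuous f.norm_coe_le_norm
    refine ⟨g, ?_⟩
    ext k
    rw [hA']
    simp only [hg]
    exact dress_add_kint hs (polyGrowth_bcf f) k
  let e := ContinuousLinearEquiv.ofBijective A (LinearMap.ker_eq_bot.2 hinj)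
    (LinearMap.range_eq_top.2 hsurj)
  -- The columns of `-α` are the images of the columns of `K` under the bounded inverse, and the
  -- latter have norm at most `C`; the `+ 1` only makes the bound positive.
  refine ⟨‖(e.symm : BoundedContinuousFunction ℝ ℝ →L[ℝ] BoundedContinuousFunction ℝ ℝ)‖ * C + 1,
    by have := hC.nonneg; positivity, bddKer_alpha_of_bound hK hr hs fun k k' => ?_⟩
  obtain ⟨κ, hκ, hκ'⟩ := exists_bcf (hC.swap.continuous_right k') (fun k => hC.bound k k')
  obtain ⟨g, hg⟩ := hlift _ _ (hC.swap.continuous_right k') (fun k => hC.bound k k')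
  have h1 : e g = κ := by
    ext l
    change A g l = _
    rw [hA', hκ]
    simp only [hg]
    exact dress_add_kint hs (hK.polyGrowth_left k') l
  have h2 : e.symm κ = g := by rw [← h1, e.symm_apply_apply]
  have h3 : |alpha K s k k'| = |g k| := by rw [hg, alpha, abs_neg]
  rw [h3]
  calc |g k| ≤ ‖g‖ := g.norm_coe_le_norm k
    _ ≤ ‖(e.symm : BoundedContinuousFunction ℝ ℝ →L[ℝ] BoundedContinuousFunction ℝ ℝ)‖ * ‖κ‖ := by
      rw [← h2]
      exact (e.symm : BoundedContinuousFunction ℝ ℝ →L[ℝ]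
        BoundedContinuousFunction ℝ ℝ).le_opNorm κ
    _ ≤ _ := by
      have : ‖(e.symm : BoundedContinuousFunction ℝ ℝ →L[ℝ] BoundedContinuousFunction ℝ ℝ)‖ * ‖κ‖ ≤
        ‖(e.symm : BoundedContinuousFunction ℝ ℝ →L[ℝ] BoundedContinuousFunction ℝ ℝ)‖ * C := by
        gcongr
      linarith

lemma swap_alpha {K : ℝ → ℝ → ℝ} {s : ℝ → ℝ} (hK : IsTBAKernel K) (hr : Rapid s)
    (hs : DressingExists K s) : (fun k k' => alpha K s k' k) = alpha K s := by
  ext k k'; exact alpha_symm hK hr hs _ _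

lemma kint_mul_kint_alpha {K : ℝ → ℝ → ℝ} {s h : ℝ → ℝ} (hK : IsTBAKernel K) (hr : Rapid s)
    (hs : DressingExists K s) (hh : Integrable h) (k : ℝ) :
    kint K (fun l => s l * kint (alpha K s) h l) k = -kint (alpha K s) h k - kint K h k := by
  obtain ⟨C, hC⟩ := hK.bddKer
  obtain ⟨M, -, hM⟩ := exists_bound_alpha hK hr hs
  rw [kint_kint hC hM hr.integrable hh]
  have : ∀ k', ∫ l, K k l * (s l * alpha K s l k') = -K k k' - alpha K s k k' :=
    fun k' => kint_mul_alpha hK hs k k'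
  simp only [this]
  calc _ = ∫ k', (-(alpha K s k k' * h k') - K k k' * h k') := by congr 1; ext; ring
    _ = _ := by
      rw [integral_sub _ (hC.integrable_mul hh k), integral_neg]
      · rfl
      · exact (hM.integrable_mul hh k).neg

/-- Resolvent identity for two local states. -/
lemma IsDressed.eq_dress_add {K : ℝ → ℝ → ℝ} {s s' f g : ℝ → ℝ} (hK : IsTBAKernel K)
    (hr : Rapid s) (hs : DressingExists K s) (hr' : Rapid s') (hf : PolyGrowth f)
    (hg : IsDressed K s' f g) (k : ℝ) :
    g k = dress K s f k + kint (alpha K s) (fun l => (s' l - s l) * g l) k := by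
  obtain ⟨C, hC⟩ := hK.bddKer
  obtain ⟨M, -, hM⟩ := exists_bound_alpha hK hr hs
  obtain ⟨hg1, hg2⟩ := isDressed_iff.1 hg
  have hi := ((hr'.sub hr).mul_poly hg1).integrable
  have hp := polyGrowth_kint hM hi
  -- With `δ = s' - s`, the identity `K s α = -α - K` gives `(1 + K s)(g - α δ g) = g + K s g + K δ
  -- g = g + K s' g = f`.
  suffices h : IsDressed K s f
      (fun k => g k - kint (alpha K s) (fun l => (s' l - s l) * g l) k) by
    have := congrFun (h.eq_dress hs hf) k
    linarith
  refine isDressed_iff.2 ⟨hg1.sub hp, fun k => ?_⟩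
  simp only [mul_sub]
  rw [kint_sub hC (hr.mul_poly hg1).integrable (hr.mul_poly hp).integrable,
    kint_mul_kint_alpha hK hr hs hi, ← hg2 k]
  have : kint K (fun l => (s' l - s l) * g l) k =
      kint K (fun l => s' l * g l) k - kint K (fun l => s l * g l) k := by
    rw [← kint_sub hC (hr'.mul_poly hg1).integrable (hr.mul_poly hg1).integrable]
    simp only [sub_mul]
  linarith

lemma dress_eq_add_kint {K : ℝ → ℝ → ℝ} {s f : ℝ → ℝ} (hK : IsTBAKernel K)
    (hr : Rapid s) (hs : DressingExists K s) (hf : PolyGrowth f) (k : ℝ) :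
    dress K s f k = f k + kint (alpha K s) (fun l => s l * f l) k := by
  have h0 : Rapid (fun _ => (0 : ℝ)) := ⟨continuous_const, fun N => ⟨0, fun k => by simp⟩⟩
  -- In the zero state dressing is the identity, so the resolvent identity with `s' = 0` reads `f =
  -- U f - α s f`.
  have hd : IsDressed K (fun _ => 0) f f := isDressed_iff.2 ⟨hf, fun k => by simp [kint]⟩
  have := hd.eq_dress_add hK hr hs h0 hf k
  have e : kint (alpha K s) (fun l => (0 - s l) * f l) k =
      -1 * kint (alpha K s) (fun l => s l * f l) k := by
    rw [← kint_const_mul]; congr 1; ext; ring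
  rw [e] at this
  linarith

/-- A solution of `r = α δ (u + r)` with small `δ` is controlled by `u`. -/
lemma abs_le_of_small {a : ℝ → ℝ → ℝ} {M : ℝ} (ha : BddKer a M) {δ u r : ℝ → ℝ}
    (hδ : Rapid δ) (hu : PolyGrowth u) (hr : PolyGrowth r) (hM : M * ∫ l, |δ l| ≤ 1 / 2)
    (h : ∀ k, r k = kint a (fun l => δ l * (u l + r l)) k) (k : ℝ) :
    |r k| ≤ 2 * M * ∫ l, |δ l * u l| := by
  -- Only the weighted integrals `B` and `J` are compared, so `u` may be unbounded. From `|r| ≤ M (B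
  -- + J)` and smallness of `M ∫ |δ|` follows `J ≤ (B + J) / 2`, that is `J ≤ B`.
  set J := ∫ l, |δ l * r l| with hJ
  set B := ∫ l, |δ l * u l| with hB
  have hM0 := ha.nonneg
  have hiu := (hδ.mul_poly hu).integrable
  have hir := (hδ.mul_poly hr).integrable
  have h1 : ∀ k, |r k| ≤ M * (B + J) := fun k => by
    rw [h k]
    refine (abs_kint_le ha (hδ.mul_poly (hu.add hr)).integrable k).trans
      (mul_le_mul_of_nonneg_left ?_ hM0)
    rw [hB, hJ, ← integral_add hiu.abs hir.abs]
    refine integral_mono (hδ.mul_poly (hu.add hr)).integrable.abs (hiu.abs.add hir.abs) fun l => ?_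
    simp only [mul_add]
    exact abs_add_le _ _
  have hB0 : 0 ≤ B := by positivity
  have hJ0 : 0 ≤ J := by positivity
  have h2 : J ≤ (∫ l, |δ l|) * (M * (B + J)) := by
    rw [hJ, ← integral_mul_const]
    refine integral_mono hir.abs (hδ.integrable.abs.mul_const _) fun l => ?_
    change |δ l * r l| ≤ |δ l| * (M * (B + J))
    rw [abs_mul]
    exact mul_le_mul_of_nonneg_left (h1 l) (abs_nonneg _)
  have h3 : J ≤ 1 / 2 * (B + J) := h2.trans (by
    calc _ = (M * ∫ l, |δ l|) * (B + J) := by ring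
      _ ≤ _ := by gcongr)
  have h4 : J ≤ B := by linarith
  calc |r k| ≤ M * (B + J) := h1 k
    _ ≤ M * (B + B) := by gcongr
    _ = _ := by ring

/-- The dressing operator exists in all states close to one in which it exists. -/
lemma DressingExists.perturb {K : ℝ → ℝ → ℝ} {s s' : ℝ → ℝ} (hK : IsTBAKernel K)
    (hr : Rapid s) (hs : DressingExists K s) (hr' : Rapid s') {M : ℝ}
    (hM : BddKer (alpha K s) M) (hsmall : M * ∫ l, |s' l - s l| ≤ 1 / 2) :
    DressingExists K s' := by
  intro f hf
  obtain ⟨C, hC⟩ := hK.bddKer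
  have hδ := hr'.sub hr
  set δ := fun l => s' l - s l with hδd
  refine existsUnique_of_exists_of_unique ?_ fun g g' hg hg' => ?_
  -- Existence: `f` may grow, so the solution is sought as `U[s] f + r` with a bounded correction
  -- satisfying `(1 - α δ) r = α δ U[s] f`. The operator `α δ` has norm at most `1/2`, so a Neumann
  -- series inverts `1 - α δ`.
  · have hu := polyGrowth_dress hs hf
    have hi := (hδ.mul_poly hu).integrable
    obtain ⟨b, hb, -⟩ := exists_bcf (continuous_kint hM hi) (abs_kint_le hM hi)
    obtain ⟨v, hv⟩ := isUnit_one_sub_of_norm_lt_one (x := kernelOp hM hδ.integrable)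
      ((norm_kernelOp_le hM hδ.integrable).trans_lt (by linarith))
    set r := (↑v⁻¹ : BoundedContinuousFunction ℝ ℝ →L[ℝ] BoundedContinuousFunction ℝ ℝ) b with hrd
    have hrb : r - kernelOp hM hδ.integrable r = b := by
      have h1 : ((v : BoundedContinuousFunction ℝ ℝ →L[ℝ] BoundedContinuousFunction ℝ ℝ) *
        (↑v⁻¹ : BoundedContinuousFunction ℝ ℝ →L[ℝ] BoundedContinuousFunction ℝ ℝ)) b = b := by
        rw [Units.mul_inv]; rfl
      rw [hv] at h1
      exact h1
    have hp := polyGrowth_bcf r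
    have hg : ∀ k, r k = kint (alpha K s) (fun l => δ l * (dress K s f l + r l)) k := fun k => by
      have h1 := congrArg (fun z : BoundedContinuousFunction ℝ ℝ => z k) hrb
      simp only [BoundedContinuousFunction.sub_apply, kernelOp_apply, hb] at h1
      simp only [mul_add]
      rw [kint_add hM hi (hδ.mul_poly hp).integrable]
      linarith
    have hgp := hu.add hp
    refine ⟨fun k => dress K s f k + r k, isDressed_iff.2 ⟨hgp, fun k => ?_⟩⟩
    have hi' := (hδ.mul_poly hgp).integrable
    have e1 := kint_mul_kint_alpha hK hr hs hi' k
    simp only [← hg] at e1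
    have e2 : kint K (fun l => δ l * (dress K s f l + r l)) k =
        kint K (fun l => s' l * (dress K s f l + r l)) k -
        kint K (fun l => s l * (dress K s f l + r l)) k := by
      rw [← kint_sub hC (hr'.mul_poly hgp).integrable (hr.mul_poly hgp).integrable]
      simp only [hδd, sub_mul]
    have e3 : kint K (fun l => s l * (dress K s f l + r l)) k =
        kint K (fun l => s l * dress K s f l) k + kint K (fun l => s l * r l) k := by
      rw [← kint_add hC (hr.mul_poly hu).integrable (hr.mul_poly hp).integrable]
      simp only [mul_add]
    linarith [dress_add_kint hs hf k]
  -- Uniqueness: the difference `d` of two solutions satisfies `d = α δ d`, which is the case `u =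
  -- 0` of `abs_le_of_small`.
  · have h1 := hg.eq_dress_add hK hr hs hr' hf
    have h2 := hg'.eq_dress_add hK hr hs hr' hf
    have hp := hg.1.sub hg'.1
    have h3 := abs_le_of_small hM hδ (PolyGrowth.const 0) hp hsmall (fun k => by
      simp only [zero_add, mul_sub]
      rw [kint_sub hM (hδ.mul_poly hg.1).integrable (hδ.mul_poly hg'.1).integrable]
      linarith [h1 k, h2 k])
    ext k
    have := h3 k
    simp only [mul_zero, abs_zero, integral_zero] at this
    linarith [abs_nonpos_iff.1 this]

lemma abs_dress_sub_le {K : ℝ → ℝ → ℝ} {s s' f : ℝ → ℝ} (hK : IsTBAKernel K)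
    (hr : Rapid s) (hs : DressingExists K s) (hr' : Rapid s') (hs' : DressingExists K s') {M : ℝ}
    (hM : BddKer (alpha K s) M) (hsmall : M * ∫ l, |s' l - s l| ≤ 1 / 2) (hf : PolyGrowth f)
    (k : ℝ) : |dress K s' f k - dress K s f k| ≤ 2 * M * ∫ l, |(s' l - s l) * dress K s f l| := by
  refine abs_le_of_small hM (hr'.sub hr) (polyGrowth_dress hs hf)
    ((polyGrowth_dress hs' hf).sub (polyGrowth_dress hs hf)) hsmall (fun k => ?_) k
  have := (isDressed_dress hs' hf).eq_dress_add hK hr hs hr' hf k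
  simp only [add_sub_cancel]
  linarith

/-! ### Differentiating the dressing operator -/

lemma hasDerivAt_zero_of_sq_bound {R : ℝ → ℝ} {t₀ C : ℝ} (h0 : R t₀ = 0)
    (h : ∀ᶠ t in 𝓝 t₀, |R t| ≤ C * (t - t₀) ^ 2) : HasDerivAt R 0 t₀ := by
  rw [hasDerivAt_iff_isLittleO]
  simp only [h0, sub_zero, smul_zero]
  refine Asymptotics.IsBigO.trans_isLittleO ?_
    (Asymptotics.isLittleO_pow_sub_sub t₀ (one_lt_two))
  refine Asymptotics.IsBigO.of_bound C (h.mono fun t ht => ?_)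
  simpa using ht

lemma hasDerivAt_of_sq_bound {R : ℝ → ℝ} {t₀ C R' : ℝ}
    (h : ∀ᶠ t in 𝓝 t₀, |R t - R t₀ - (t - t₀) * R'| ≤ C * (t - t₀) ^ 2) :
    HasDerivAt R R' t₀ := by
  have h1 : HasDerivAt (fun t => R t - R t₀ - (t - t₀) * R') 0 t₀ :=
    hasDerivAt_zero_of_sq_bound (by simp) h
  have h2 : HasDerivAt (fun t => R t₀ + (t - t₀) * R') R' t₀ := by
    simpa using (((hasDerivAt_id t₀).sub_const t₀).mul_const R').const_add (R t₀)
  have := h1.add h2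
  rw [zero_add] at this
  exact this.congr_of_eventuallyEq (Eventually.of_forall fun t => by simp)

lemma abs_sub_le_of_hasDerivAt {u u' : ℝ → ℝ} {B : ℝ} (h : ∀ t, HasDerivAt u (u' t) t)
    (hB : ∀ t, |u' t| ≤ B) (t t₀ : ℝ) : |u t - u t₀| ≤ B * |t - t₀| :=
  Convex.norm_image_sub_le_of_norm_hasDerivWithin_le (s := Set.univ)
    (fun x _ => (h x).hasDerivWithinAt) (fun x _ => hB x) convex_univ trivial trivial

/-- `∂ₜ (U[sₜ] f)(k) = ∫ α(k,k') ∂ₜsₜ(k') (U f)(k') dk'`. -/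
lemma hasDerivAt_dress {K : ℝ → ℝ → ℝ} {f : ℝ → ℝ} {s s' : ℝ → ℝ → ℝ} {t₀ : ℝ}
    (hK : IsTBAKernel K) (hr : ∀ t, Rapid (s t)) (hd : ∀ t k, HasDerivAt (fun t => s t k) (s' t k) t)
    (hs' : ∀ N : ℕ, ∃ C, ∀ t k, (1 + |k|) ^ N * |s' t k| ≤ C) (hc : Continuous (s' t₀))
    (he : DressingExists K (s t₀)) (hf : PolyGrowth f) (k : ℝ) :
    HasDerivAt (fun t => dress K (s t) f k)
      (kint (alpha K (s t₀)) (fun l => s' t₀ l * dress K (s t₀) f l) k) t₀ := by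
  obtain ⟨M, hM0, hM⟩ := exists_bound_alpha hK (hr t₀) he
  have hg := polyGrowth_dress he hf
  set g := dress K (s t₀) f with hgd
  -- Two spare powers of `1 + |l|` make the bound integrable; the mean value inequality turns the
  -- bound on `s'` into a Lipschitz bound on `s`.
  have hbd : ∀ u : ℝ → ℝ, PolyGrowth u → ∃ C, (∀ t l, |s' t l * u l| ≤ C * (1 + l ^ 2)⁻¹) ∧
      ∀ t l, |(s t l - s t₀ l) * u l| ≤ C * (1 + l ^ 2)⁻¹ * |t - t₀| := by
    rintro u ⟨-, C, N, hu⟩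
    obtain ⟨C', hC'⟩ := hs' (2 + N)
    have h1 : ∀ t l, |s' t l * u l| ≤ C' * |C| * (1 + l ^ 2)⁻¹ := fun t l => by
      refine abs_le_inv_one_add_sq ?_
      have h2 : |u l| ≤ |C| * (1 + |l|) ^ N := (hu l).trans (by gcongr; exact le_abs_self C)
      rw [abs_mul]
      calc (1 + |l|) ^ 2 * (|s' t l| * |u l|)
          ≤ (1 + |l|) ^ 2 * (|s' t l| * (|C| * (1 + |l|) ^ N)) := by gcongr
        _ = ((1 + |l|) ^ (2 + N) * |s' t l|) * |C| := by ring
        _ ≤ C' * |C| := by gcongr; exact hC' t l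
    refine ⟨_, h1, fun t l => ?_⟩
    have := abs_sub_le_of_hasDerivAt (fun t => (hd t l).mul_const (u l)) (h1 · l) t t₀
    rwa [← sub_mul] at this
  have hbi : ∀ u : ℝ → ℝ, PolyGrowth u → ∃ C, ∀ t,
      ∫ l, |(s t l - s t₀ l) * u l| ≤ C * |t - t₀| := by
    intro u hu
    obtain ⟨C, -, hC⟩ := hbd u hu
    refine ⟨C * ∫ l : ℝ, (1 + l ^ 2)⁻¹, fun t => ?_⟩
    rw [← integral_const_mul, ← integral_mul_const]
    exact integral_mono (((hr t).sub (hr t₀)).mul_poly hu).integrable.abs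
      ((integrable_inv_one_add_sq.const_mul C).mul_const _) (hC t)
  obtain ⟨C₁, hC₁⟩ := hbi _ (PolyGrowth.const 1)
  simp only [mul_one] at hC₁
  obtain ⟨C₂, hC₂⟩ := hbi _ hg
  have hsmall : ∀ᶠ t in 𝓝 t₀, M * ∫ l, |s t l - s t₀ l| ≤ 1 / 2 := by
    have : Tendsto (fun t => M * (C₁ * |t - t₀|)) (𝓝 t₀) (𝓝 0) := by
      have : Continuous fun t => M * (C₁ * |t - t₀|) := by fun_prop
      simpa using this.tendsto t₀
    filter_upwards [this.eventually_le_const (show (0 : ℝ) < 1 / 2 by norm_num)] with t ht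
    exact (mul_le_mul_of_nonneg_left (hC₁ t) hM0.le).trans ht
  -- the linear part
  have hlin : HasDerivAt (fun t => kint (alpha K (s t₀)) (fun l => (s t l - s t₀ l) * g l) k)
      (kint (alpha K (s t₀)) (fun l => s' t₀ l * g l) k) t₀ := by
    obtain ⟨C, hC, -⟩ := hbd _ hg
    refine (hasDerivAt_integral_of_dominated_loc_of_deriv_le (s := Set.univ)
      (bound := fun l => M * (C * (1 + l ^ 2)⁻¹))
      (F' := fun t l => alpha K (s t₀) k l * (s' t l * g l)) univ_mem
      (Eventually.of_forall fun t => ?_) ?_ ?_ (ae_of_all _ fun l t _ => ?_)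
      ((integrable_inv_one_add_sq.const_mul C).const_mul M) (ae_of_all _ fun l t _ => ?_)).2
    · exact ((hM.continuous_right k).mul
        (((hr t).1.sub (hr t₀).1).mul hg.1)).aestronglyMeasurable
    · exact hM.integrable_mul (((hr t₀).sub (hr t₀)).mul_poly hg).integrable k
    · exact ((hM.continuous_right k).mul (hc.mul hg.1)).aestronglyMeasurable
    · rw [Real.norm_eq_abs, abs_mul]
      exact mul_le_mul (hM.bound k l) (hC t l) (abs_nonneg _) hM0.le
    · exact (((hd t l).sub_const _).mul_const _).const_mul _
  have hlin0 : kint (alpha K (s t₀)) (fun l => (s t₀ l - s t₀ l) * g l) k = 0 := by simp [kint]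
  -- the quadratic remainder
  have hrem : HasDerivAt (fun t => dress K (s t) f k - g k -
      kint (alpha K (s t₀)) (fun l => (s t l - s t₀ l) * g l) k) 0 t₀ := by
    refine hasDerivAt_zero_of_sq_bound (C := M * (C₁ * (2 * M * C₂))) (by rw [hlin0]; simp [hgd])
      (hsmall.mono fun t ht => ?_)
    have het := he.perturb hK (hr t₀) (hr t) hM ht
    have hpt := polyGrowth_dress het hf
    have hδ := (hr t).sub (hr t₀)
    have e := (isDressed_dress het hf).eq_dress_add hK (hr t₀) he (hr t) hf k
    -- The remainder equals `α δ (U[sₜ] f - U f)` with `δ = sₜ - s_{t₀}`; both `δ`, in the integral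
    -- norm, and the difference of dressed functions are of order `|t - t₀|`.
    have e2 : dress K (s t) f k - g k -
        kint (alpha K (s t₀)) (fun l => (s t l - s t₀ l) * g l) k =
        kint (alpha K (s t₀)) (fun l => (s t l - s t₀ l) * (dress K (s t) f l - g l)) k := by
      simp only [mul_sub]
      rw [kint_sub hM (hδ.mul_poly hpt).integrable (hδ.mul_poly hg).integrable]
      linarith
    rw [e2]
    refine (abs_kint_le hM (hδ.mul_poly (hpt.sub hg)).integrable k).trans ?_
    have h3 : ∫ l, |(s t l - s t₀ l) * (dress K (s t) f l - g l)| ≤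
        (∫ l, |s t l - s t₀ l|) * (2 * M * (C₂ * |t - t₀|)) := by
      rw [← integral_mul_const]
      refine integral_mono (hδ.mul_poly (hpt.sub hg)).integrable.abs
        (hδ.integrable.abs.mul_const _) fun l => ?_
      change |(s t l - s t₀ l) * (dress K (s t) f l - g l)| ≤ _
      rw [abs_mul]
      refine mul_le_mul_of_nonneg_left ?_ (abs_nonneg _)
      refine (abs_dress_sub_le hK (hr t₀) he (hr t) het hM ht hf l).trans ?_
      exact mul_le_mul_of_nonneg_left (hC₂ t) (by positivity)
    have h4 : 0 ≤ 2 * M * (C₂ * |t - t₀|) :=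
      mul_nonneg (by positivity) ((by positivity : (0 : ℝ) ≤ _).trans (hC₂ t))
    calc _ ≤ M * ((C₁ * |t - t₀|) * (2 * M * (C₂ * |t - t₀|))) := by
          refine mul_le_mul_of_nonneg_left (h3.trans ?_) hM0.le
          exact mul_le_mul_of_nonneg_right (hC₁ t) h4
      _ = M * (C₁ * (2 * M * C₂)) * (|t - t₀| * |t - t₀|) := by ring
      _ = _ := by rw [abs_mul_abs_self]; ring
  have := (hrem.add hlin).add_const (g k)
  rw [zero_add] at this
  exact this.congr_of_eventuallyEq (Eventually.of_forall fun t => by simp)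

/-! ### Decaying and tempered functions on phase space -/

/-- Jointly continuous functions decaying like `1 / (1 + x²)` in position and faster than any power
in rapidity. -/
structure Decays (G : ℝ → ℝ → ℝ) : Prop where
  continuous : Continuous (fun p : ℝ × ℝ => G p.1 p.2)
  decay : ∀ N : ℕ, ∃ C, ∀ x k, (1 + x ^ 2) * (1 + |k|) ^ N * |G x k| ≤ C

/-- Jointly continuous functions of at most polynomial growth in rapidity, uniformly in position. -/
structure Tempered (f : ℝ → ℝ → ℝ) : Prop where
  continuous : Continuous (fun p : ℝ × ℝ => f p.1 p.2)
  growth : ∃ (C : ℝ) (N : ℕ), ∀ x k, |f x k| ≤ C * (1 + |k|) ^ N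

lemma PolyGrowth.tempered {f : ℝ → ℝ} (hf : PolyGrowth f) : Tempered (fun _ k => f k) :=
  ⟨hf.1.comp continuous_snd, hf.2.imp fun _ => .imp fun _ h _ => h⟩

lemma Tempered.polyGrowth {f : ℝ → ℝ → ℝ} (hf : Tempered f) (x : ℝ) : PolyGrowth (f x) :=
  ⟨hf.continuous.comp (Continuous.prodMk_right x), hf.growth.imp fun _ => .imp fun _ h => h x⟩

lemma Tempered.add {f g : ℝ → ℝ → ℝ} (hf : Tempered f) (hg : Tempered g) :
    Tempered (fun x k => f x k + g x k) := by
  obtain ⟨hf, C, N, hC⟩ := hf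
  obtain ⟨hg, C', N', hC'⟩ := hg
  refine ⟨hf.add hg, |C| + |C'|, N + N', fun x k => (abs_add_le _ _).trans ?_⟩
  have e1 := one_le_one_add_abs_pow k N
  have e2 := one_le_one_add_abs_pow k N'
  rw [pow_add, add_mul]
  refine add_le_add ((hC x k).trans ?_) ((hC' x k).trans ?_)
  · calc C * (1 + |k|) ^ N ≤ |C| * (1 + |k|) ^ N := by gcongr; exact le_abs_self C
      _ ≤ _ := by gcongr; nlinarith
  · calc C' * (1 + |k|) ^ N' ≤ |C'| * (1 + |k|) ^ N' := by gcongr; exact le_abs_self C'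
      _ ≤ _ := by gcongr; nlinarith

lemma Tempered.mul {f g : ℝ → ℝ → ℝ} (hf : Tempered f) (hg : Tempered g) :
    Tempered (fun x k => f x k * g x k) := by
  obtain ⟨hf, C, N, hC⟩ := hf
  obtain ⟨hg, C', N', hC'⟩ := hg
  refine ⟨hf.mul hg, C * C', N + N', fun x k => ?_⟩
  rw [abs_mul, pow_add]
  calc |f x k| * |g x k| ≤ (C * (1 + |k|) ^ N) * (C' * (1 + |k|) ^ N') :=
        mul_le_mul (hC x k) (hC' x k) (abs_nonneg _) ((abs_nonneg _).trans (hC x k))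
    _ = _ := by ring

lemma Tempered.const_mul {f : ℝ → ℝ → ℝ} (hf : Tempered f) (c : ℝ) :
    Tempered (fun x k => c * f x k) :=
  (PolyGrowth.const c).tempered.mul hf

lemma Decays.rapid {G : ℝ → ℝ → ℝ} (hG : Decays G) (x : ℝ) : Rapid (G x) := by
  refine ⟨hG.continuous.comp (Continuous.prodMk_right x), fun N => ?_⟩
  obtain ⟨C, hC⟩ := hG.decay N
  refine ⟨C, fun k => le_trans ?_ (hC x k)⟩
  rw [mul_assoc]
  exact le_mul_of_one_le_left (by positivity) (by nlinarith [sq_nonneg x])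

lemma Decays.weighted_bound {G : ℝ → ℝ → ℝ} (hG : Decays G) (N : ℕ) :
    ∃ C, ∀ x k, (1 + |k|) ^ N * |G x k| ≤ C := by
  obtain ⟨C, hC⟩ := hG.decay N
  refine ⟨C, fun x k => le_trans ?_ (hC x k)⟩
  rw [mul_assoc]
  exact le_mul_of_one_le_left (by positivity) (by nlinarith [sq_nonneg x])

lemma Decays.tempered {G : ℝ → ℝ → ℝ} (hG : Decays G) : Tempered G := by
  obtain ⟨C, hC⟩ := hG.weighted_bound 0
  exact ⟨hG.continuous, C, 0, fun x k => by simpa using hC x k⟩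

lemma Decays.mul_tempered {G f : ℝ → ℝ → ℝ} (hG : Decays G) (hf : Tempered f) :
    Decays (fun x k => G x k * f x k) := by
  obtain ⟨hf, C, N, hC⟩ := hf
  refine ⟨hG.continuous.mul hf, fun n => ?_⟩
  obtain ⟨C', hC'⟩ := hG.decay (n + N)
  refine ⟨C' * |C|, fun x k => ?_⟩
  have h2 : |f x k| ≤ |C| * (1 + |k|) ^ N := (hC x k).trans (by gcongr; exact le_abs_self C)
  rw [abs_mul]
  calc (1 + x ^ 2) * (1 + |k|) ^ n * (|G x k| * |f x k|)
      ≤ (1 + x ^ 2) * (1 + |k|) ^ n * (|G x k| * (|C| * (1 + |k|) ^ N)) := by gcongr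
    _ = ((1 + x ^ 2) * (1 + |k|) ^ (n + N) * |G x k|) * |C| := by ring
    _ ≤ C' * |C| := by gcongr; exact hC' x k

lemma Decays.add {G H : ℝ → ℝ → ℝ} (hG : Decays G) (hH : Decays H) :
    Decays (fun x k => G x k + H x k) := by
  refine ⟨hG.continuous.add hH.continuous, fun N => ?_⟩
  obtain ⟨C, hC⟩ := hG.decay N
  obtain ⟨C', hC'⟩ := hH.decay N
  refine ⟨C + C', fun x k => ?_⟩
  calc _ ≤ (1 + x ^ 2) * (1 + |k|) ^ N * (|G x k| + |H x k|) := by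
        gcongr; exact abs_add_le _ _
    _ ≤ C + C' := by linarith [hC x k, hC' x k]

lemma Decays.const_mul {G : ℝ → ℝ → ℝ} (hG : Decays G) (c : ℝ) :
    Decays (fun x k => c * G x k) := by
  simpa only [mul_comm] using hG.mul_tempered (PolyGrowth.const c).tempered

lemma Decays.exists_abs_le {G : ℝ → ℝ → ℝ} (hG : Decays G) :
    ∃ C, ∀ x k, |G x k| ≤ C * ((1 + x ^ 2)⁻¹ * (1 + k ^ 2)⁻¹) := by
  obtain ⟨C, hC⟩ := hG.decay 2
  refine ⟨C, fun x k => ?_⟩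
  rw [← mul_inv, ← div_eq_mul_inv, le_div_iff₀ (by positivity)]
  refine le_trans ?_ (hC x k)
  rw [mul_comm]
  gcongr
  exact one_add_sq_le k

lemma inv_one_add_sq_le_one (x : ℝ) : (1 + x ^ 2)⁻¹ ≤ 1 :=
  inv_le_one_of_one_le₀ (by nlinarith [sq_nonneg x])

lemma Decays.exists_abs_le_right {G : ℝ → ℝ → ℝ} (hG : Decays G) :
    ∃ C, ∀ x k, |G x k| ≤ C * (1 + k ^ 2)⁻¹ := by
  obtain ⟨C, hC⟩ := hG.weighted_bound 2
  exact ⟨C, fun x k => abs_le_inv_one_add_sq (hC x k)⟩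

lemma Decays.integrable_prod {G : ℝ → ℝ → ℝ} (hG : Decays G) :
    Integrable (fun p : ℝ × ℝ => G p.1 p.2) := by
  obtain ⟨C, hC⟩ := hG.exists_abs_le
  exact ((integrable_inv_one_add_sq.mul_prod integrable_inv_one_add_sq).const_mul C).mono'
    hG.continuous.aestronglyMeasurable (ae_of_all _ fun p => hC p.1 p.2)

lemma Decays.exists_integral_abs_le {G : ℝ → ℝ → ℝ} (hG : Decays G) :
    ∃ C, ∀ x, ∫ k, |G x k| ≤ C * (1 + x ^ 2)⁻¹ := by
  obtain ⟨C, hC⟩ := hG.exists_abs_le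
  refine ⟨C * ∫ k : ℝ, (1 + k ^ 2)⁻¹, fun x => ?_⟩
  rw [← integral_const_mul, ← integral_mul_const]
  refine integral_mono (hG.rapid x).integrable.abs
    ((integrable_inv_one_add_sq.const_mul C).mul_const _) fun k => (hC x k).trans_eq ?_
  ring

lemma Decays.tendsto_integral_abs_sub {G : ℝ → ℝ → ℝ} (hG : Decays G) (x₀ : ℝ) :
    Tendsto (fun x => ∫ k, |G x k - G x₀ k|) (𝓝 x₀) (𝓝 0) := by
  obtain ⟨C, hC⟩ := hG.exists_abs_le_right
  have hc : Continuous (fun x => ∫ k, |G x k - G x₀ k|) := by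
    refine continuous_of_dominated (bound := fun k => 2 * (C * (1 + k ^ 2)⁻¹))
      (fun x => ((hG.rapid x).sub (hG.rapid x₀)).1.abs.aestronglyMeasurable)
      (fun x => ae_of_all _ fun k => ?_) ((integrable_inv_one_add_sq.const_mul C).const_mul 2)
      (ae_of_all _ fun k => ?_)
    · rw [Real.norm_eq_abs, abs_abs]
      linarith [abs_sub (G x k) (G x₀ k), hC x k, hC x₀ k]
    · exact ((hG.continuous.comp (Continuous.prodMk_left k)).sub continuous_const).abs
  simpa using hc.tendsto x₀

lemma tendsto_inv_one_add_sq : Tendsto (fun x : ℝ => (1 + x ^ 2)⁻¹) (cocompact ℝ) (𝓝 0) := by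
  have h : Tendsto (fun x : ℝ => ‖x‖ ^ 2) (cocompact ℝ) atTop :=
    (tendsto_pow_atTop two_ne_zero).comp tendsto_norm_cocompact_atTop
  refine (tendsto_inv_atTop_zero.comp (tendsto_atTop_add_const_left _ 1 h)).congr fun x => ?_
  simp

lemma tendsto_zero_of_abs_le_inv_one_add_sq {u : ℝ → ℝ} {C : ℝ}
    (h : ∀ x, |u x| ≤ C * (1 + x ^ 2)⁻¹) : Tendsto u (cocompact ℝ) (𝓝 0) :=
  squeeze_zero_norm h (by simpa using tendsto_inv_one_add_sq.const_mul C)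

/-! ### The dressing operator along a field -/

lemma rapid_zero : Rapid (fun _ => 0) :=
  ⟨continuous_const, fun _ => ⟨0, fun k => by simp⟩⟩

lemma dressingExists_zero (K : ℝ → ℝ → ℝ) : DressingExists K (fun _ => 0) := fun f hf =>
  ⟨f, isDressed_iff.2 ⟨hf, fun k => by simp [kint]⟩, fun g hg => by
    ext k; simpa [kint] using (isDressed_iff.1 hg).2 k⟩

/-- The filter is arbitrary so that the same estimate serves near a finite point, with `s = θ x₀`,
and at infinity, with `s = 0`. There `2 M ∫ |θ x - s| M ≤ M`, so the bound at most doubles. -/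
lemma eventually_bound_alpha {K : ℝ → ℝ → ℝ} {θ : ℝ → ℝ → ℝ} {l : Filter ℝ} {s : ℝ → ℝ}
    (hK : IsTBAKernel K) (hθ : Decays θ) (hU : ∀ x, DressingExists K (θ x)) (hr : Rapid s)
    (hs : DressingExists K s) (h : Tendsto (fun x => ∫ k, |θ x k - s k|) l (𝓝 0)) :
    ∃ M, ∀ᶠ x in l, ∀ k k', |alpha K (θ x) k k'| ≤ M := by
  obtain ⟨M, hM0, hM⟩ := exists_bound_alpha hK hr hs
  refine ⟨2 * M, ?_⟩
  have h1 : Tendsto (fun x => M * ∫ k, |θ x k - s k|) l (𝓝 0) := by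
    simpa using h.const_mul M
  filter_upwards [h1.eventually_le_const (show (0 : ℝ) < 1 / 2 by norm_num)] with x hx k k'
  have hf := hK.polyGrowth_left k'
  have h2 := abs_dress_sub_le hK hr hs (hθ.rapid x) (hU x) hM hx hf k
  have h3 : ∫ l, |(θ x l - s l) * dress K s (fun k => K k k') l| ≤ (∫ l, |θ x l - s l|) * M := by
    rw [← integral_mul_const]
    have hδ := (hθ.rapid x).sub hr
    refine integral_mono (hδ.mul_poly (polyGrowth_dress hs hf)).integrable.abs
      (hδ.integrable.abs.mul_const _) fun l => ?_
    change |(θ x l - s l) * dress K s (fun k => K k k') l| ≤ _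
    rw [abs_mul]
    refine mul_le_mul_of_nonneg_left ?_ (abs_nonneg _)
    simpa [alpha] using hM.bound l k'
  have h4 : |dress K s (fun k => K k k') k| ≤ M := by simpa [alpha] using hM.bound k k'
  have h5 : 2 * M * (∫ l, |(θ x l - s l) * dress K s (fun k => K k k') l|) ≤ M := by
    calc _ ≤ 2 * M * ((∫ l, |θ x l - s l|) * M) := by gcongr
      _ = 2 * (M * ∫ l, |θ x l - s l|) * M := by ring
      _ ≤ 2 * (1 / 2) * M := by gcongr
      _ = M := by ring
  rw [alpha, abs_neg]
  calc _ = |(dress K (θ x) (fun k => K k k') k - dress K s (fun k => K k k') k) +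
        dress K s (fun k => K k k') k| := by rw [sub_add_cancel]
    _ ≤ M + M := (abs_add_le _ _).trans (add_le_add (h2.trans h5) h4)
    _ = 2 * M := by ring

/-- The field tends to the zero state at infinity, where dressing is trivial. This bounds `α` off a
compact set, and local bounds cover the compact set. -/
lemma exists_uniform_bound_alpha {K : ℝ → ℝ → ℝ} {θ : ℝ → ℝ → ℝ} (hK : IsTBAKernel K)
    (hθ : Decays θ) (hU : ∀ x, DressingExists K (θ x)) :
    ∃ M > 0, ∀ x, BddKer (alpha K (θ x)) M := by
  have hinf : ∃ M, ∀ᶠ x in cocompact ℝ, ∀ k k', |alpha K (θ x) k k'| ≤ M := by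
    refine eventually_bound_alpha hK hθ hU rapid_zero (dressingExists_zero K) ?_
    obtain ⟨C, hC⟩ := hθ.exists_integral_abs_le
    refine tendsto_zero_of_abs_le_inv_one_add_sq (C := C) fun x => ?_
    simp only [sub_zero]
    rw [abs_of_nonneg (by positivity)]
    exact hC x
  obtain ⟨M₁, hM₁⟩ := hinf
  obtain ⟨t, ht, htM⟩ := mem_cocompact.1 hM₁
  have hcomp : ∃ M, ∀ x ∈ t, ∀ k k', |alpha K (θ x) k k'| ≤ M := by
    refine ht.induction_on (p := fun S => ∃ M, ∀ x ∈ S, ∀ k k', |alpha K (θ x) k k'| ≤ M)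
      ⟨0, by simp⟩ ?_ ?_ ?_
    · rintro S T hST ⟨M, hM⟩
      exact ⟨M, fun x hx => hM x (hST hx)⟩
    · rintro S T ⟨M, hM⟩ ⟨M', hM'⟩
      refine ⟨max M M', fun x hx k k' => hx.elim (fun h => ?_) fun h => ?_⟩
      exacts [(hM x h k k').trans (le_max_left _ _), (hM' x h k k').trans (le_max_right _ _)]
    · intro x _
      obtain ⟨M, hM⟩ := eventually_bound_alpha hK hθ hU (hθ.rapid x) (hU x)
        (hθ.tendsto_integral_abs_sub x)
      exact ⟨_, mem_nhdsWithin_of_mem_nhds hM, M, fun y hy => hy⟩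
  obtain ⟨M₂, hM₂⟩ := hcomp
  refine ⟨max 1 (max M₁ M₂), by positivity, fun x => bddKer_alpha_of_bound hK (hθ.rapid x) (hU x)
    fun k k' => ?_⟩
  by_cases hx : x ∈ t
  · exact (hM₂ x hx k k').trans ((le_max_right _ _).trans (le_max_right _ _))
  · exact (htM hx k k').trans ((le_max_left _ _).trans (le_max_right _ _))

/-- The perturbation estimate is uniform in `k`, so continuity in `x` and continuity in `k` combine
to joint continuity. -/
lemma continuous_dress {K : ℝ → ℝ → ℝ} {θ : ℝ → ℝ → ℝ} {f : ℝ → ℝ} (hK : IsTBAKernel K)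
    (hθ : Decays θ) (hU : ∀ x, DressingExists K (θ x)) (hf : PolyGrowth f) :
    Continuous (fun p : ℝ × ℝ => dress K (θ p.1) f p.2) := by
  refine continuous_iff_continuousAt.2 fun ⟨x₀, k₀⟩ => ?_
  obtain ⟨M, hM0, hM⟩ := exists_bound_alpha hK (hθ.rapid x₀) (hU x₀)
  have hg := polyGrowth_dress (hU x₀) hf
  have h1 : Tendsto (fun x => M * ∫ k, |θ x k - θ x₀ k|) (𝓝 x₀) (𝓝 0) := by
    simpa using (hθ.tendsto_integral_abs_sub x₀).const_mul M
  have h2 : Tendsto (fun x => 2 * M * ∫ k, |(θ x k - θ x₀ k) * dress K (θ x₀) f k|)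
      (𝓝 x₀) (𝓝 0) := by
    have := ((hθ.mul_tempered hg.tempered).tendsto_integral_abs_sub x₀).const_mul (2 * M)
    simpa only [mul_zero, ← sub_mul] using this
  have h3 : Tendsto (fun p : ℝ × ℝ => dress K (θ p.1) f p.2 - dress K (θ x₀) f p.2)
      (𝓝 (x₀, k₀)) (𝓝 0) := by
    have hfst : Tendsto Prod.fst (𝓝 (x₀, k₀)) (𝓝 x₀) := continuous_fst.tendsto _
    refine squeeze_zero_norm' ?_ (h2.comp hfst)
    filter_upwards [hfst.eventually
      (h1.eventually_le_const (show (0 : ℝ) < 1 / 2 by norm_num))] with p hp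
    exact abs_dress_sub_le hK (hθ.rapid x₀) (hU x₀) (hθ.rapid p.1) (hU p.1) hM hp hf p.2
  have h4 : Tendsto (fun p : ℝ × ℝ => dress K (θ x₀) f p.2) (𝓝 (x₀, k₀))
      (𝓝 (dress K (θ x₀) f k₀)) := (hg.1.comp continuous_snd).tendsto _
  have := h3.add h4
  simpa [ContinuousAt] using this

lemma continuous_alpha {K : ℝ → ℝ → ℝ} {θ : ℝ → ℝ → ℝ} (hK : IsTBAKernel K)
    (hθ : Decays θ) (hU : ∀ x, DressingExists K (θ x)) :
    Continuous (fun p : ℝ × ℝ × ℝ => alpha K (θ p.1) p.2.1 p.2.2) := by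
  obtain ⟨C, hC⟩ := hK.bddKer
  obtain ⟨M, hM0, hM⟩ := exists_uniform_bound_alpha hK hθ hU
  obtain ⟨B, hB⟩ := hθ.exists_abs_le_right
  have e : (fun p : ℝ × ℝ × ℝ => alpha K (θ p.1) p.2.1 p.2.2) = fun p =>
      -K p.2.1 p.2.2 - ∫ l, K p.2.1 l * (θ p.1 l * alpha K (θ p.1) l p.2.2) := by
    ext p
    have := kint_mul_alpha hK (hU p.1) p.2.1 p.2.2
    rw [kint] at this
    linarith
  rw [e]
  refine (hC.continuous.comp continuous_snd).neg.sub ?_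
  refine continuous_of_dominated (bound := fun l => C * (B * (1 + l ^ 2)⁻¹ * M))
    (fun p => (hC.integrable_mul ((hθ.rapid p.1).mul_poly
      (polyGrowth_alpha_left hK (hU p.1) p.2.2)).integrable _).1)
    (fun p => ae_of_all _ fun l => ?_)
    (((integrable_inv_one_add_sq.const_mul B).mul_const M).const_mul C)
    (ae_of_all _ fun l => ?_)
  · rw [Real.norm_eq_abs, abs_mul, abs_mul]
    have h0 := hC.nonneg
    have h1 := (hM p.1).nonneg
    exact mul_le_mul (hC.bound _ _) (mul_le_mul (hB _ _) ((hM p.1).bound _ _) (abs_nonneg _)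
      ((abs_nonneg _).trans (hB p.1 l))) (by positivity) h0
  · refine ((hC.swap.continuous_right l).comp (continuous_fst.comp continuous_snd)).mul
      (((hθ.continuous.comp (Continuous.prodMk_left l)).comp continuous_fst).mul ?_)
    -- Symmetry moves the variable into the first slot, where `continuous_dress` applies with the
    -- fixed source `K(·,l)`.
    have h2 : (fun p : ℝ × ℝ × ℝ => alpha K (θ p.1) l p.2.2) = fun p : ℝ × ℝ × ℝ =>
        -dress K (θ p.1) (fun k => K k l) p.2.2 := by
      ext p; rw [alpha_symm hK (hθ.rapid p.1) (hU p.1)]; rfl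
    rw [h2]
    exact ((continuous_dress hK hθ hU (hK.polyGrowth_left l)).comp
      (continuous_fst.prodMk (continuous_snd.comp continuous_snd))).neg

lemma exists_abs_kint_alpha_le {K : ℝ → ℝ → ℝ} {θ G : ℝ → ℝ → ℝ} (hK : IsTBAKernel K)
    (hθ : Decays θ) (hU : ∀ x, DressingExists K (θ x)) (hG : Decays G) :
    ∃ C, ∀ x k, |kint (alpha K (θ x)) (G x) k| ≤ C * (1 + x ^ 2)⁻¹ := by
  obtain ⟨M, hM0, hM⟩ := exists_uniform_bound_alpha hK hθ hU
  obtain ⟨C, hC⟩ := hG.exists_integral_abs_le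
  refine ⟨M * C, fun x k => (abs_kint_le (hM x) (hG.rapid x).integrable k).trans ?_⟩
  rw [mul_assoc]
  exact mul_le_mul_of_nonneg_left (hC x) hM0.le

lemma continuous_kint_alpha {K : ℝ → ℝ → ℝ} {θ G : ℝ → ℝ → ℝ} (hK : IsTBAKernel K)
    (hθ : Decays θ) (hU : ∀ x, DressingExists K (θ x)) (hG : Decays G) :
    Continuous (fun p : ℝ × ℝ => kint (alpha K (θ p.1)) (G p.1) p.2) := by
  obtain ⟨M, hM0, hM⟩ := exists_uniform_bound_alpha hK hθ hU
  obtain ⟨B, hB⟩ := hG.exists_abs_le_right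
  refine continuous_of_dominated (bound := fun l => M * (B * (1 + l ^ 2)⁻¹))
    (fun p => ((hM p.1).integrable_mul (hG.rapid p.1).integrable _).1)
    (fun p => ae_of_all _ fun l => ?_)
    ((integrable_inv_one_add_sq.const_mul B).const_mul M) (ae_of_all _ fun l => ?_)
  · rw [Real.norm_eq_abs, abs_mul]
    exact mul_le_mul ((hM p.1).bound _ _) (hB _ _) (abs_nonneg _) hM0.le
  · exact ((continuous_alpha hK hθ hU).comp (continuous_fst.prodMk
      (continuous_snd.prodMk continuous_const))).mul (hG.continuous.comp
        (continuous_fst.prodMk continuous_const))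

lemma tempered_kint_alpha {K : ℝ → ℝ → ℝ} {θ G : ℝ → ℝ → ℝ} (hK : IsTBAKernel K)
    (hθ : Decays θ) (hU : ∀ x, DressingExists K (θ x)) (hG : Decays G) :
    Tempered (fun x k => kint (alpha K (θ x)) (G x) k) := by
  obtain ⟨C, hC⟩ := exists_abs_kint_alpha_le hK hθ hU hG
  refine ⟨continuous_kint_alpha hK hθ hU hG, |C|, 0, fun x k => (hC x k).trans ?_⟩
  rw [pow_zero, mul_one]
  exact (le_abs_self _).trans (by
    rw [abs_mul, abs_of_nonneg (inv_nonneg.2 (by positivity : 0 ≤ 1 + x ^ 2))]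
    exact mul_le_of_le_one_right (abs_nonneg C) (inv_one_add_sq_le_one x))

lemma tempered_dress {K : ℝ → ℝ → ℝ} {θ : ℝ → ℝ → ℝ} {f : ℝ → ℝ} (hK : IsTBAKernel K)
    (hθ : Decays θ) (hU : ∀ x, DressingExists K (θ x)) (hf : PolyGrowth f) :
    Tempered (fun x k => dress K (θ x) f k) := by
  have h := hf.tempered.add
    (tempered_kint_alpha hK hθ hU (hθ.mul_tempered hf.tempered))
  refine ⟨continuous_dress hK hθ hU hf, ?_⟩
  obtain ⟨C, N, hC⟩ := h.growth
  exact ⟨C, N, fun x k => by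
    rw [dress_eq_add_kint hK (hθ.rapid x) (hU x) hf]; exact hC x k⟩

/-- `∂ₓ (U f) = α θₓ U f`. -/
lemma hasDerivAt_dress_field {K : ℝ → ℝ → ℝ} {θ θ' : ℝ → ℝ → ℝ} {f : ℝ → ℝ}
    (hK : IsTBAKernel K) (hθ : Decays θ) (hθ' : Decays θ')
    (hd : ∀ x k, HasDerivAt (fun y => θ y k) (θ' x k) x) (hU : ∀ x, DressingExists K (θ x))
    (hf : PolyGrowth f) (x k : ℝ) :
    HasDerivAt (fun y => dress K (θ y) f k)
      (kint (alpha K (θ x)) (fun l => θ' x l * dress K (θ x) f l) k) x :=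
  hasDerivAt_dress hK hθ.rapid hd hθ'.weighted_bound (hθ'.rapid x).1 (hU x) hf k

lemma hasDerivAt_alpha_field {K : ℝ → ℝ → ℝ} {θ θ' : ℝ → ℝ → ℝ}
    (hK : IsTBAKernel K) (hθ : Decays θ) (hθ' : Decays θ')
    (hd : ∀ x k, HasDerivAt (fun y => θ y k) (θ' x k) x) (hU : ∀ x, DressingExists K (θ x))
    (x k k' : ℝ) :
    HasDerivAt (fun y => alpha K (θ y) k k')
      (kint (alpha K (θ x)) (fun l => θ' x l * alpha K (θ x) l k') k) x := by
  have h := (hasDerivAt_dress_field hK hθ hθ' hd hU (hK.polyGrowth_left k') x k).neg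
  refine h.congr_deriv ?_
  rw [← neg_one_mul, ← kint_const_mul]
  congr 1; ext l; simp only [alpha]; ring

/-- `∂ₓ (α G) = α θₓ α G + α Gₓ`. -/
lemma hasDerivAt_kint_alpha {K : ℝ → ℝ → ℝ} {θ θ' G G' : ℝ → ℝ → ℝ}
    (hK : IsTBAKernel K) (hθ : Decays θ) (hθ' : Decays θ')
    (hd : ∀ x k, HasDerivAt (fun y => θ y k) (θ' x k) x) (hU : ∀ x, DressingExists K (θ x))
    (hG : Decays G) (hG' : Decays G') (hGd : ∀ x k, HasDerivAt (fun y => G y k) (G' x k) x)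
    (x k : ℝ) :
    HasDerivAt (fun y => kint (alpha K (θ y)) (G y) k)
      (kint (alpha K (θ x)) (fun l => θ' x l * kint (alpha K (θ x)) (G x) l) k +
        kint (alpha K (θ x)) (G' x) k) x := by
  obtain ⟨M, hM0, hM⟩ := exists_uniform_bound_alpha hK hθ hU
  obtain ⟨B, hB⟩ := hG.exists_abs_le_right
  obtain ⟨B', hB'⟩ := hG'.exists_abs_le_right
  -- The `x`-derivative of `α(k,l)`, read as a function of `l`: a bounded continuous kernel in
  -- `(l,m)` applied to `θ'`, which makes it continuous in `l`.
  have hα' : ∀ y l, kint (alpha K (θ y)) (fun m => θ' y m * alpha K (θ y) m l) k =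
      kint (fun l m => alpha K (θ y) m l * alpha K (θ y) k m) (θ' y) l := fun y l => by
    rw [kint, kint]; congr 1; ext; ring
  obtain ⟨T, hT⟩ : ∃ T, ∀ y l, |kint (alpha K (θ y)) (fun m => θ' y m * alpha K (θ y) m l) k| ≤
      T := by
    obtain ⟨C, hC⟩ := hθ'.exists_abs_le_right
    refine ⟨∫ m : ℝ, M * (C * (1 + m ^ 2)⁻¹ * M), fun y l => ?_⟩
    rw [kint, ← Real.norm_eq_abs]
    refine norm_integral_le_of_norm_le
      (((integrable_inv_one_add_sq.const_mul C).mul_const M).const_mul M)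
      (ae_of_all _ fun m => ?_)
    rw [Real.norm_eq_abs, abs_mul, abs_mul]
    exact mul_le_mul ((hM y).bound _ _) (mul_le_mul (hC _ _) ((hM y).bound _ _) (abs_nonneg _)
      ((abs_nonneg _).trans (hC y m))) (by positivity) hM0.le
  have hcont : Continuous fun l =>
      kint (alpha K (θ x)) (fun m => θ' x m * alpha K (θ x) m l) k := by
    simp only [hα']
    refine continuous_kint (M := M * M) ⟨?_, fun l m => ?_⟩ (hθ'.rapid x).integrable
    · exact (hM x).swap.continuous.mul (((hM x).continuous_right k).comp continuous_snd)
    · rw [abs_mul]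
      exact mul_le_mul ((hM x).bound _ _) ((hM x).bound _ _) (abs_nonneg _) hM0.le
  have h := hasDerivAt_integral_of_dominated_loc_of_deriv_le (s := Set.univ) (μ := volume)
      (F := fun y l => alpha K (θ y) k l * G y l) (x₀ := x)
      (bound := fun l => T * (B * (1 + l ^ 2)⁻¹) + M * (B' * (1 + l ^ 2)⁻¹))
      (F' := fun y l => kint (alpha K (θ y)) (fun m => θ' y m * alpha K (θ y) m l) k * G y l +
        alpha K (θ y) k l * G' y l) univ_mem
      (Eventually.of_forall fun y => ((hM y).integrable_mul (hG.rapid y).integrable k).1)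
      ((hM x).integrable_mul (hG.rapid x).integrable k)
      ((hcont.mul (hG.rapid x).1).add
        (((hM x).continuous_right k).mul (hG'.rapid x).1)).aestronglyMeasurable
      (ae_of_all _ fun l y _ => by
        rw [Real.norm_eq_abs]
        refine (abs_add_le _ _).trans (add_le_add ?_ ?_) <;> rw [abs_mul]
        · exact mul_le_mul (hT y l) (hB y l) (abs_nonneg _) ((abs_nonneg _).trans (hT y l))
        · exact mul_le_mul ((hM y).bound _ _) (hB' y l) (abs_nonneg _) hM0.le)
      (((integrable_inv_one_add_sq.const_mul B).const_mul T).add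
        ((integrable_inv_one_add_sq.const_mul B').const_mul M))
      (ae_of_all _ fun l y _ =>
        (hasDerivAt_alpha_field hK hθ hθ' hd hU y k l).mul (hGd y l))
  refine h.2.congr_deriv ?_
  have hi : Integrable fun l =>
      kint (alpha K (θ x)) (fun m => θ' x m * alpha K (θ x) m l) k * G x l :=
    (hG.rapid x).integrable.bdd_mul hcont.aestronglyMeasurable (ae_of_all _ (hT x))
  rw [integral_add hi ((hM x).integrable_mul (hG'.rapid x).integrable k),
    kint_kint (hM x) (hM x) (hθ'.rapid x).integrable (hG.rapid x).integrable]
  congr 1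
  simp only [kint, mul_comm]

/-! ### Functionals `∫∫ P' (a θ + c θ²) q` and their functional derivatives -/

/-- The density `(a θ + c θ²) q`. -/
def density (a c : ℝ) (q : ℝ → ℝ) (θ : ℝ → ℝ → ℝ) (x k : ℝ) : ℝ :=
  (a * θ x k + c * θ x k ^ 2) * q k

/-- The functional `∫ dx ∫ dk P' (a θ + c θ²) q`. -/
def energy (K : ℝ → ℝ → ℝ) (a c : ℝ) (q : ℝ → ℝ) (θ : ℝ → ℝ → ℝ) : ℝ :=
  ∫ x, ∫ k, dP K (θ x) k * density a c q θ x k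

/-- The determination `α (a θ + c θ²) q + a q` of the non-local term. -/
def potential (K : ℝ → ℝ → ℝ) (a c : ℝ) (q : ℝ → ℝ) (θ : ℝ → ℝ → ℝ) (x k : ℝ) : ℝ :=
  kint (alpha K (θ x)) (density a c q θ x) k + a * q k

/-- The functional derivative of `energy`, divided by `P'`. -/
def reducedVar (K : ℝ → ℝ → ℝ) (a c : ℝ) (q : ℝ → ℝ) (θ : ℝ → ℝ → ℝ) (x k : ℝ) : ℝ :=
  potential K a c q θ x k + 2 * c * (θ x k * q k)

/-- The functional derivative of `energy`. -/
def variation (K : ℝ → ℝ → ℝ) (a c : ℝ) (q : ℝ → ℝ) (θ : ℝ → ℝ → ℝ) (x k : ℝ) : ℝ :=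
  dP K (θ x) k * reducedVar K a c q θ x k

lemma Decays.integrable_integral {G : ℝ → ℝ → ℝ} (hG : Decays G) :
    Integrable (fun x => ∫ k, G x k) :=
  hG.integrable_prod.integral_prod_left

lemma Decays.integral_prod_eq {G : ℝ → ℝ → ℝ} (hG : Decays G) :
    ∫ p : ℝ × ℝ, G p.1 p.2 = ∫ x, ∫ k, G x k :=
  integral_prod _ hG.integrable_prod

lemma Decays.abs {G : ℝ → ℝ → ℝ} (hG : Decays G) : Decays (fun x k => |G x k|) :=
  ⟨hG.continuous.abs, fun N => (hG.decay N).imp fun C h x k => by rw [abs_abs]; exact h x k⟩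

lemma decays_of_hasCompactSupport {η : ℝ → ℝ → ℝ} (hc : Continuous (fun p : ℝ × ℝ => η p.1 p.2))
    (hs : HasCompactSupport (fun p : ℝ × ℝ => η p.1 p.2)) : Decays η := by
  refine ⟨hc, fun N => ?_⟩
  have h1 : Continuous (fun p : ℝ × ℝ => (1 + p.1 ^ 2) * (1 + |p.2|) ^ N * η p.1 p.2) := by
    fun_prop
  have h2 : HasCompactSupport (fun p : ℝ × ℝ => (1 + p.1 ^ 2) * (1 + |p.2|) ^ N * η p.1 p.2) :=
    hs.mul_left
  obtain ⟨C, hC⟩ := h1.bounded_above_of_compact_support h2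
  refine ⟨C, fun x k => ?_⟩
  have := hC (x, k)
  rwa [Real.norm_eq_abs, abs_mul, abs_of_nonneg (by positivity)] at this

lemma decays_density {θ : ℝ → ℝ → ℝ} {q : ℝ → ℝ} (hθ : Decays θ) (hq : PolyGrowth q) (a c : ℝ) :
    Decays (density a c q θ) := by
  have h := ((hθ.const_mul a).add ((hθ.mul_tempered hθ.tempered).const_mul c)).mul_tempered
    hq.tempered
  have e : density a c q θ = fun x k => (a * θ x k + c * (θ x k * θ x k)) * q k := by
    ext x k; simp only [density, pow_two]
  rwa [e]

lemma tempered_potential {K θ : ℝ → ℝ → ℝ} {q : ℝ → ℝ} (hK : IsTBAKernel K)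
    (hθ : Decays θ) (hU : ∀ x, DressingExists K (θ x)) (hq : PolyGrowth q) (a c : ℝ) :
    Tempered (potential K a c q θ) :=
  (tempered_kint_alpha hK hθ hU (decays_density hθ hq a c)).add (hq.tempered.const_mul a)

lemma tempered_reducedVar {K θ : ℝ → ℝ → ℝ} {q : ℝ → ℝ} (hK : IsTBAKernel K)
    (hθ : Decays θ) (hU : ∀ x, DressingExists K (θ x)) (hq : PolyGrowth q) (a c : ℝ) :
    Tempered (reducedVar K a c q θ) :=
  (tempered_potential hK hθ hU hq a c).add
    ((hθ.mul_tempered hq.tempered).tempered.const_mul (2 * c))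

lemma tempered_dP {K θ : ℝ → ℝ → ℝ} (hK : IsTBAKernel K)
    (hθ : Decays θ) (hU : ∀ x, DressingExists K (θ x)) :
    Tempered (fun x k => dP K (θ x) k) :=
  tempered_dress hK hθ hU (PolyGrowth.const 1)

lemma tempered_variation {K θ : ℝ → ℝ → ℝ} {q : ℝ → ℝ} (hK : IsTBAKernel K)
    (hθ : Decays θ) (hU : ∀ x, DressingExists K (θ x)) (hq : PolyGrowth q) (a c : ℝ) :
    Tempered (variation K a c q θ) :=
  (tempered_dP hK hθ hU).mul (tempered_reducedVar hK hθ hU hq a c)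

/-- The symmetric form of Fubini's theorem for the resolvent kernel. -/
lemma integral_mul_kint_alpha {K : ℝ → ℝ → ℝ} {s g h : ℝ → ℝ} (hK : IsTBAKernel K) (hr : Rapid s)
    (hs : DressingExists K s) (hg : Integrable g) (hh : Integrable h) :
    ∫ k, g k * kint (alpha K s) h k = ∫ k, h k * kint (alpha K s) g k := by
  obtain ⟨M, -, hM⟩ := exists_bound_alpha hK hr hs
  rw [integral_mul_kint hM hg hh, swap_alpha hK hr hs]

/-- The exact increment of the energy density. -/
lemma integral_energy_sub {K θ ζ : ℝ → ℝ → ℝ} {q : ℝ → ℝ} (hK : IsTBAKernel K)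
    (hθ : Decays θ) (hU : ∀ x, DressingExists K (θ x)) (hζ : Decays ζ)
    (hU' : ∀ x, DressingExists K (fun k => θ x k + ζ x k)) (hq : PolyGrowth q) (a c x : ℝ) :
    (∫ k, dP K (fun l => θ x l + ζ x l) k * density a c q (fun x k => θ x k + ζ x k) x k) -
      ∫ k, dP K (θ x) k * density a c q θ x k =
    ∫ k, ζ x k * (dP K (fun l => θ x l + ζ x l) k *
      (reducedVar K a c q θ x k + c * (ζ x k * q k))) := by
  have hθζ := hθ.add hζ
  have hp := (tempered_dP hK hθ hU).polyGrowth x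
  have hp' := (tempered_dP hK hθζ hU').polyGrowth x
  have hd := (decays_density hθ hq a c).rapid x
  have hd' := (decays_density hθζ hq a c).rapid x
  have hζp := (hζ.rapid x).mul_poly hp'
  have hkd := (tempered_kint_alpha hK hθ hU (decays_density hθ hq a c)).polyGrowth x
  -- The resolvent identity for `f = 1` keeps the perturbed `P'` on the right, so no remainder
  -- arises. Paired with the density, `α` is moved across by symmetry in `hsw`.
  have e : ∀ k, dP K (fun l => θ x l + ζ x l) k = dP K (θ x) k +
      kint (alpha K (θ x)) (fun l => ζ x l * dP K (fun l => θ x l + ζ x l) l) k := fun k => by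
    have := (isDressed_dress (hU' x) (PolyGrowth.const 1)).eq_dress_add hK (hθ.rapid x) (hU x)
      (hθζ.rapid x) (PolyGrowth.const 1) k
    simp only [add_sub_cancel_left] at this
    exact this
  have hsw := integral_mul_kint_alpha hK (hθ.rapid x) (hU x) hd.integrable hζp.integrable
  have h1 : ∀ k, density a c q θ x k *
      kint (alpha K (θ x)) (fun l => ζ x l * dP K (fun l => θ x l + ζ x l) l) k =
      dP K (fun l => θ x l + ζ x l) k * density a c q θ x k -
        dP K (θ x) k * density a c q θ x k := fun k => by
    linear_combination (-density a c q θ x k) * e k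
  simp only [h1] at hsw
  rw [integral_sub (hd.poly_mul hp').integrable (hd.poly_mul hp).integrable] at hsw
  rw [← sub_add_sub_cancel _ (∫ k, dP K (fun l => θ x l + ζ x l) k * density a c q θ x k), hsw,
    ← integral_sub (hd'.poly_mul hp').integrable (hd.poly_mul hp').integrable,
    ← integral_add ((hd'.poly_mul hp').sub (hd.poly_mul hp')).integrable
      (hζp.mul_poly hkd).integrable]
  congr 1; ext k
  simp only [density, reducedVar, potential]
  ring

/-- With `ζ = ε η` the exact increment is `∫ ε η P'_ε (G + c ε η q)`. Replacing `P'_ε` by `P'` costs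
`O(ε)`, so the deviation from the linear term is `O(ε²)`. -/
lemma energy_hasFunctionalDeriv {K θ : ℝ → ℝ → ℝ} {q : ℝ → ℝ} (hK : IsTBAKernel K)
    (hθ : Decays θ) (hU : ∀ x, DressingExists K (θ x)) (hq : PolyGrowth q) (a c : ℝ) :
    HasFunctionalDeriv (energy K a c q) θ (variation K a c q θ) := by
  refine ⟨(tempered_variation hK hθ hU hq a c).continuous, fun η hη hηs => ?_⟩
  have hη := decays_of_hasCompactSupport hη.continuous hηs
  obtain ⟨M, hM0, hM⟩ := exists_uniform_bound_alpha hK hθ hU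
  have hp := tempered_dP hK hθ hU
  have hG := tempered_reducedVar hK hθ hU hq a c
  obtain ⟨E, hE⟩ : ∃ E, ∀ x, ∫ k, |η x k| ≤ E := by
    obtain ⟨C, hC⟩ := hη.exists_integral_abs_le
    exact ⟨|C|, fun x => (hC x).trans ((mul_le_mul_of_nonneg_right (le_abs_self C)
      (by positivity)).trans (mul_le_of_le_one_right (abs_nonneg C) (inv_one_add_sq_le_one x)))⟩
  obtain ⟨E', hE'⟩ : ∃ E, ∀ x, ∫ k, |η x k * dP K (θ x) k| ≤ E := by
    obtain ⟨C, hC⟩ := (hη.mul_tempered hp).exists_integral_abs_le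
    exact ⟨|C|, fun x => (hC x).trans ((mul_le_mul_of_nonneg_right (le_abs_self C)
      (by positivity)).trans (mul_le_of_le_one_right (abs_nonneg C) (inv_one_add_sq_le_one x)))⟩
  have hE'0 : 0 ≤ E' := (by positivity : (0 : ℝ) ≤ _).trans (hE' 0)
  -- The majorant of the remainder divided by `ε²`. Its three terms come from `P'_ε - P'` against
  -- `G`, from `c ε η q` against `P'`, and from the product of both corrections; the last is cubic
  -- and is reduced by `|ε| ≤ 1`.
  set R : ℝ → ℝ → ℝ := fun x k => 2 * M * E' * |η x k * reducedVar K a c q θ x k| +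
    (|c * (η x k * (η x k * q k) * dP K (θ x) k)| +
      2 * M * E' * |c * (η x k * (η x k * q k))|) with hRd
  have hηηq := hη.mul_tempered (hη.mul_tempered hq.tempered).tempered
  have hR : Decays R := ((hη.mul_tempered hG).abs.const_mul _).add
    (((hηηq.mul_tempered hp).const_mul c).abs.add ((hηηq.const_mul c).abs.const_mul _))
  have hv : Decays fun x k => η x k * (dP K (θ x) k * reducedVar K a c q θ x k) :=
    hη.mul_tempered (hp.mul hG)
  have hve : ∫ p : ℝ × ℝ, variation K a c q θ p.1 p.2 * η p.1 p.2 =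
      ∫ x, ∫ k, η x k * (dP K (θ x) k * reducedVar K a c q θ x k) := by
    rw [← hv.integral_prod_eq]
    congr 1; ext p; simp only [variation]; ring
  have hsmall : ∀ᶠ ε in 𝓝 (0 : ℝ), M * (|ε| * E) ≤ 1 / 2 ∧ |ε| ≤ 1 := by
    have h1 : Continuous fun ε : ℝ => M * (|ε| * E) := by fun_prop
    have h2 : Tendsto (fun ε : ℝ => M * (|ε| * E)) (𝓝 0) (𝓝 0) := by simpa using h1.tendsto 0
    have h3 : Tendsto (fun ε : ℝ => |ε|) (𝓝 0) (𝓝 0) := by simpa using continuous_abs.tendsto (0:ℝ)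
    exact (h2.eventually_le_const (by norm_num)).and (h3.eventually_le_const (by norm_num))
  refine hasDerivAt_of_sq_bound (C := ∫ x, ∫ k, R x k) (hsmall.mono fun ε hε => ?_)
  obtain ⟨hε, hε1⟩ := hε
  have hζ : Decays fun x k => ε * η x k := hη.const_mul ε
  have hsm : ∀ x, M * ∫ l, |θ x l + ε * η x l - θ x l| ≤ 1 / 2 := fun x => by
    refine le_trans ?_ hε
    simp only [add_sub_cancel_left, abs_mul, integral_const_mul]
    gcongr
    exact hE x
  have hU' : ∀ x, DressingExists K (fun k => θ x k + ε * η x k) := fun x =>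
    (hU x).perturb hK (hθ.rapid x) ((hθ.add hζ).rapid x) (hM x) (hsm x)
  have hp' := tempered_dP hK (hθ.add hζ) hU'
  have hdp : ∀ x k, |dP K (fun k => θ x k + ε * η x k) k - dP K (θ x) k| ≤ |ε| * (2 * M * E') := by
    intro x k
    refine (abs_dress_sub_le hK (hθ.rapid x) (hU x) ((hθ.add hζ).rapid x) (hU' x) (hM x) (hsm x)
      (PolyGrowth.const 1) k).trans ?_
    have : ∫ l, |(θ x l + ε * η x l - θ x l) * dress K (θ x) (fun _ => 1) l| =
        |ε| * ∫ l, |η x l * dP K (θ x) l| := by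
      rw [← integral_const_mul]
      congr 1; ext l; rw [add_sub_cancel_left, mul_assoc, abs_mul]; rfl
    rw [this]
    calc _ ≤ 2 * M * (|ε| * E') := by gcongr; exact hE' x
      _ = _ := by ring
  have hslice : ∀ x, |(∫ k, dP K (fun l => θ x l + ε * η x l) k *
      density a c q (fun x k => θ x k + ε * η x k) x k) -
      (∫ k, dP K (θ x) k * density a c q θ x k) -
      ε * ∫ k, η x k * (dP K (θ x) k * reducedVar K a c q θ x k)| ≤ ε ^ 2 * ∫ k, R x k := by
    intro x
    rw [integral_energy_sub hK hθ hU hζ hU' hq a c x, ← integral_const_mul, ← integral_const_mul,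
      ← integral_sub
        (hζ.mul_tempered (hp'.mul (hG.add
          ((hζ.mul_tempered hq.tempered).tempered.const_mul c))) |>.rapid x).integrable
        ((hv.const_mul ε).rapid x).integrable, ← Real.norm_eq_abs]
    refine norm_integral_le_of_norm_le ((hR.rapid x).integrable.const_mul _)
      (ae_of_all _ fun k => ?_)
    have h1 := hdp x k
    set p' := dP K (fun l => θ x l + ε * η x l) k
    set p := dP K (θ x) k
    set G := reducedVar K a c q θ x k
    have e : ε * η x k * (p' * (G + c * (ε * η x k * q k))) - ε * (η x k * (p * G)) =
        ε * (p' - p) * (η x k * G) + ε ^ 2 * (c * (η x k * (η x k * q k) * p)) +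
          ε ^ 2 * (p' - p) * (c * (η x k * (η x k * q k))) := by ring
    rw [Real.norm_eq_abs, e]
    have hεε : |ε| * |ε| = ε ^ 2 := by rw [abs_mul_abs_self, pow_two]
    have b1 : |ε * (p' - p) * (η x k * G)| ≤ ε ^ 2 * (2 * M * E' * |η x k * G|) := by
      rw [abs_mul, abs_mul]
      calc _ ≤ |ε| * (|ε| * (2 * M * E')) * |η x k * G| := by gcongr
        _ = (|ε| * |ε|) * (2 * M * E' * |η x k * G|) := by ring
        _ = _ := by rw [hεε]
    have b2 : |ε ^ 2 * (c * (η x k * (η x k * q k) * p))| ≤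
        ε ^ 2 * |c * (η x k * (η x k * q k) * p)| := by
      rw [abs_mul, abs_of_nonneg (sq_nonneg ε)]
    have b3 : |ε ^ 2 * (p' - p) * (c * (η x k * (η x k * q k)))| ≤
        ε ^ 2 * (2 * M * E' * |c * (η x k * (η x k * q k))|) := by
      rw [abs_mul, abs_mul, abs_of_nonneg (sq_nonneg ε), mul_assoc]
      have : |p' - p| ≤ 2 * M * E' :=
        h1.trans (mul_le_of_le_one_left (by positivity) hε1)
      gcongr
    refine (abs_add_le _ _).trans ((add_le_add ((abs_add_le _ _).trans (add_le_add b1 b2))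
      b3).trans_eq ?_)
    simp only [hRd, p, G]
    ring
  have i1 := ((decays_density (hθ.add hζ) hq a c).mul_tempered hp').integrable_integral
  have i2 := ((decays_density hθ hq a c).mul_tempered hp).integrable_integral
  simp only [mul_comm (density _ _ _ _ _ _)] at i1 i2
  have i3 := hv.integrable_integral.const_mul ε
  simp only [energy, zero_mul, add_zero, sub_zero]
  rw [hve, ← integral_const_mul, ← integral_sub i1 i2, ← integral_sub (by exact i1.sub i2) i3, mul_comm,
    ← integral_const_mul, ← Real.norm_eq_abs]
  exact norm_integral_le_of_norm_le (hR.integrable_integral.const_mul _) (ae_of_all _ hslice)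

/-- The fundamental lemma of the calculus of variations. It reduces the quantification over all
functional derivatives in `HasBracket` to `variation`. -/
lemma HasFunctionalDeriv.unique {I : (ℝ → ℝ → ℝ) → ℝ} {θ D D' : ℝ → ℝ → ℝ}
    (h : HasFunctionalDeriv I θ D) (h' : HasFunctionalDeriv I θ D') : D = D' := by
  have hc : Continuous (fun p : ℝ × ℝ => D p.1 p.2 - D' p.1 p.2) := h.1.sub h'.1
  have h0 : (fun p : ℝ × ℝ => D p.1 p.2 - D' p.1 p.2) = fun _ => 0 := by
    refine (hc.ae_eq_iff_eq volume continuous_const).1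
      (ae_eq_zero_of_integral_contDiff_smul_eq_zero hc.locallyIntegrable fun g hg hgs => ?_)
    have e := (h.2 (fun x k => g (x, k)) hg hgs).unique (h'.2 (fun x k => g (x, k)) hg hgs)
    have i : ∀ D : ℝ → ℝ → ℝ, Continuous (fun p : ℝ × ℝ => D p.1 p.2) →
        Integrable (fun p : ℝ × ℝ => D p.1 p.2 * g p) := fun D hD =>
      (hD.mul hg.continuous).integrable_of_hasCompactSupport hgs.mul_left
    simp only [Prod.mk.eta] at e
    simp only [smul_eq_mul, mul_comm (g _), sub_mul]
    rw [integral_sub (i D h.1) (i D' h'.1), e, sub_self]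
  ext x k
  exact sub_eq_zero.1 (congrFun h0 (x, k))

/-! ### Phase points -/

lemma IsField.decays {θ : ℝ → ℝ → ℝ} (h : IsField θ) : Decays θ :=
  ⟨by simpa using h.continuous 0 (by norm_num), fun N => by simpa using h.decay 0 (by norm_num) N⟩

lemma IsField.decays_dx {θ : ℝ → ℝ → ℝ} (h : IsField θ) : Decays (dx θ) :=
  ⟨by simpa [dx] using h.continuous 1 (by norm_num),
    fun N => by simpa [dx] using h.decay 1 (by norm_num) N⟩

lemma IsField.hasDerivAt {θ : ℝ → ℝ → ℝ} (h : IsField θ) (x k : ℝ) :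
    HasDerivAt (fun y => θ y k) (dx θ x k) x :=
  ((h.contDiff k).differentiable (by norm_num) x).hasDerivAt

lemma IsField.hasDerivAt_dx {θ : ℝ → ℝ → ℝ} (h : IsField θ) (x k : ℝ) :
    HasDerivAt (fun y => dx θ y k) (dx (dx θ) x k) x := by
  have h1 : ContDiff ℝ 1 (deriv fun y => θ y k) :=
    ((contDiff_succ_iff_deriv (n := 1)).1 ((h.contDiff k).of_le (by norm_num))).2.2
  exact (h1.differentiable (by norm_num) x).hasDerivAt

lemma IsPhasePoint.dressingExists {K θ : ℝ → ℝ → ℝ} (h : IsPhasePoint K θ) (x : ℝ) :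
    DressingExists K (θ x) :=
  (h.2 x).1

lemma IsPhasePoint.dP_ne_zero {K θ : ℝ → ℝ → ℝ} (h : IsPhasePoint K θ) (x k : ℝ) :
    dP K (θ x) k ≠ 0 := by
  obtain ⟨δ, hδ, hle⟩ := (h.2 x).2
  exact (hδ.trans_le (hle k)).ne'

/-! ### The bracket with `energy` -/

lemma hasDerivAt_dress_phase {K θ : ℝ → ℝ → ℝ} {q : ℝ → ℝ} (hK : IsTBAKernel K)
    (h : IsPhasePoint K θ) (hq : PolyGrowth q) (x k : ℝ) :
    HasDerivAt (fun y => dress K (θ y) q k)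
      (kint (alpha K (θ x)) (fun l => dx θ x l * dress K (θ x) q l) k) x :=
  hasDerivAt_dress_field hK h.1.decays h.1.decays_dx h.1.hasDerivAt h.dressingExists hq x k

lemma decays_density_deriv {θ : ℝ → ℝ → ℝ} {q : ℝ → ℝ} (h : IsField θ) (hq : PolyGrowth q)
    (a c : ℝ) : Decays (fun x k => dx θ x k * ((a + 2 * c * θ x k) * q k)) :=
  h.decays_dx.mul_tempered ((((PolyGrowth.const a).tempered.add
    (h.decays.tempered.const_mul (2 * c)))).mul hq.tempered)

lemma hasDerivAt_density {θ : ℝ → ℝ → ℝ} (h : IsField θ) (q : ℝ → ℝ) (a c x k : ℝ) :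
    HasDerivAt (fun y => density a c q θ y k) (dx θ x k * ((a + 2 * c * θ x k) * q k)) x := by
  have := h.hasDerivAt x k
  refine (((this.const_mul a).add ((this.pow 2).const_mul c)).mul_const (q k)).congr_deriv ?_
  ring

/-- `∂ₓ F = α θₓ G`. -/
lemma hasDerivAt_potential {K θ : ℝ → ℝ → ℝ} {q : ℝ → ℝ} (hK : IsTBAKernel K)
    (h : IsPhasePoint K θ) (hq : PolyGrowth q) (a c x k : ℝ) :
    HasDerivAt (fun y => potential K a c q θ y k)
      (kint (alpha K (θ x)) (fun l => dx θ x l * reducedVar K a c q θ x l) k) x := by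
  have hd := decays_density h.1.decays hq a c
  have hd' := decays_density_deriv h.1 hq a c
  obtain ⟨M, -, hM⟩ := exists_bound_alpha hK (h.1.decays.rapid x) (h.dressingExists x)
  refine ((hasDerivAt_kint_alpha hK h.1.decays h.1.decays_dx h.1.hasDerivAt h.dressingExists hd hd'
    (hasDerivAt_density h.1 q a c) x k).add_const (a * q k)).congr_deriv ?_
  rw [← kint_add hM ((h.1.decays_dx.mul_tempered
    (tempered_kint_alpha hK h.1.decays h.dressingExists hd)).rapid x).integrable
    (hd'.rapid x).integrable]
  congr 1; ext l
  simp only [reducedVar, potential]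
  ring

lemma hasDerivAt_reducedVar {K θ : ℝ → ℝ → ℝ} {q : ℝ → ℝ} (hK : IsTBAKernel K)
    (h : IsPhasePoint K θ) (hq : PolyGrowth q) (a c x k : ℝ) :
    HasDerivAt (fun y => reducedVar K a c q θ y k)
      (kint (alpha K (θ x)) (fun l => dx θ x l * reducedVar K a c q θ x l) k +
        2 * c * (dx θ x k * q k)) x :=
  (hasDerivAt_potential hK h hq a c x k).add
    (((h.1.hasDerivAt x k).mul_const (q k)).const_mul (2 * c))

lemma hasDerivAt_variation {K θ : ℝ → ℝ → ℝ} {q : ℝ → ℝ} (hK : IsTBAKernel K)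
    (h : IsPhasePoint K θ) (hq : PolyGrowth q) (a c x k : ℝ) :
    HasDerivAt (fun y => variation K a c q θ y k)
      (kint (alpha K (θ x)) (fun l => dx θ x l * dP K (θ x) l) k * reducedVar K a c q θ x k +
        dP K (θ x) k * (kint (alpha K (θ x)) (fun l => dx θ x l * reducedVar K a c q θ x l) k +
          2 * c * (dx θ x k * q k))) x :=
  (hasDerivAt_dress_phase hK h (PolyGrowth.const 1) x k).mul (hasDerivAt_reducedVar hK h hq a c x k)

/-- The bracket with `energy`, for the determination `potential + b`. -/
lemma bracketField_variation {K θ : ℝ → ℝ → ℝ} {q b : ℝ → ℝ} (hK : IsTBAKernel K)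
    (h : IsPhasePoint K θ) (hq : PolyGrowth q) (a c x k : ℝ)
    (hb : Integrable fun l => alpha K (θ x) k l * b l) :
    bracketField K θ (variation K a c q θ) (fun x k => potential K a c q θ x k + b k) x k =
      dx θ x k / dP K (θ x) k * (2 * c * dress K (θ x) q k - kint (alpha K (θ x)) b k) := by
  obtain ⟨M, -, hM⟩ := exists_bound_alpha hK (h.1.decays.rapid x) (h.dressingExists x)
  have hP := h.dP_ne_zero x
  have hi1 := hM.integrable_mul ((h.1.decays.mul_tempered hq.tempered).rapid x).integrable k
  have hi2 := hM.integrable_mul ((h.1.decays_dx.mul_tempered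
    (tempered_reducedVar hK h.1.decays h.dressingExists hq a c)).rapid x).integrable k
  -- `F` contains the possibly growing term `a q`, so `α F` alone may diverge. Under the common
  -- integral only `G - F = 2c θ q` appears, which decays.
  have e1 : ∫ l, (alpha K (θ x) k l / (dP K (θ x) k * dP K (θ x) l) *
      (dx θ x k - dx θ x l) * variation K a c q θ x l -
        dx θ x k / dP K (θ x) k * (alpha K (θ x) k l * (potential K a c q θ x l + b l))) =
      dx θ x k / dP K (θ x) k * (2 * c) * kint (alpha K (θ x)) (fun l => θ x l * q l) k -
      1 / dP K (θ x) k * kint (alpha K (θ x)) (fun l => dx θ x l * reducedVar K a c q θ x l) k -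
      dx θ x k / dP K (θ x) k * kint (alpha K (θ x)) b k := by
    simp only [kint, ← integral_const_mul]
    rw [← integral_sub (hi1.const_mul _) (hi2.const_mul _),
      ← integral_sub (by exact (hi1.const_mul _).sub (hi2.const_mul _)) (hb.const_mul _)]
    congr 1; ext l
    have h1 := hP k
    have h2 := hP l
    simp only [variation, reducedVar]
    field_simp
    ring
  have e2 : ∫ l, alpha K (θ x) k l * dP K (θ x) l / dP K (θ x) k * dx θ x l =
      kint (alpha K (θ x)) (fun l => dx θ x l * dP K (θ x) l) k / dP K (θ x) k := by
    rw [kint, ← integral_div]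
    congr 1; ext l; ring
  have e3 : dx (variation K a c q θ) x k = _ := (hasDerivAt_variation hK h hq a c x k).deriv
  simp only [bracketField]
  rw [e1, e2, e3, dress_eq_add_kint hK (h.1.decays.rapid x) (h.dressingExists x) hq]
  have h1 := hP k
  simp only [variation]
  field_simp
  ring

lemma kint_alpha_variation {K θ : ℝ → ℝ → ℝ} {q : ℝ → ℝ} (h : IsPhasePoint K θ) (a c x k : ℝ) :
    (fun l => alpha K (θ x) k l * (1 / dP K (θ x) l) * dx θ x l * variation K a c q θ x l) =
      fun l => alpha K (θ x) k l * (dx θ x l * reducedVar K a c q θ x l) := by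
  ext l
  have h2 := h.dP_ne_zero x l
  simp only [variation]
  field_simp

lemma alpha_mul_variation_sub {K θ : ℝ → ℝ → ℝ} {q : ℝ → ℝ} (h : IsPhasePoint K θ)
    (a c x k l : ℝ) :
    alpha K (θ x) k l * (variation K a c q θ x l / dP K (θ x) l - potential K a c q θ x l) =
      alpha K (θ x) k l * (2 * c * (θ x l * q l)) := by
  have h2 := h.dP_ne_zero x l
  simp only [variation, reducedVar]
  field_simp
  ring

lemma exists_integral_alpha_le {K θ : ℝ → ℝ → ℝ} {q : ℝ → ℝ} (hK : IsTBAKernel K)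
    (h : IsPhasePoint K θ) (hq : PolyGrowth q) (a c : ℝ) : ∃ C : ℝ, ∀ x k,
      Integrable (fun l => alpha K (θ x) k l *
        (variation K a c q θ x l / dP K (θ x) l - potential K a c q θ x l)) ∧
      ∫ l, |alpha K (θ x) k l *
        (variation K a c q θ x l / dP K (θ x) l - potential K a c q θ x l)| ≤ C := by
  obtain ⟨M, hM0, hM⟩ := exists_uniform_bound_alpha hK h.1.decays h.dressingExists
  have hG := (h.1.decays.mul_tempered hq.tempered).const_mul (2 * c)
  obtain ⟨C, hC⟩ := hG.exists_integral_abs_le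
  simp only [alpha_mul_variation_sub h]
  refine ⟨M * |C|, fun x k => ⟨(hM x).integrable_mul (hG.rapid x).integrable k, ?_⟩⟩
  calc _ ≤ ∫ l, M * |2 * c * (θ x l * q l)| := by
        refine integral_mono ((hM x).integrable_mul (hG.rapid x).integrable k).abs
          ((hG.rapid x).integrable.abs.const_mul M) fun l => ?_
        change |alpha K (θ x) k l * _| ≤ _
        rw [abs_mul]
        exact mul_le_mul_of_nonneg_right ((hM x).bound k l) (abs_nonneg _)
    _ ≤ M * |C| := by
        rw [integral_const_mul]
        refine mul_le_mul_of_nonneg_left ((hC x).trans ?_) hM0.le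
        exact (mul_le_mul_of_nonneg_right (le_abs_self C) (by positivity)).trans
          (mul_le_of_le_one_right (abs_nonneg C) (inv_one_add_sq_le_one x))

lemma isDetermination_potential {K θ : ℝ → ℝ → ℝ} {q : ℝ → ℝ} (hK : IsTBAKernel K)
    (h : IsPhasePoint K θ) (hq : PolyGrowth q) (a c : ℝ) :
    IsDetermination K θ (variation K a c q θ) (potential K a c q θ) := by
  obtain ⟨M, hM0, hM⟩ := exists_uniform_bound_alpha hK h.1.decays h.dressingExists
  have hθG := h.1.decays_dx.mul_tempered
    (tempered_reducedVar hK h.1.decays h.dressingExists hq a c)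
  have hθP := h.1.decays_dx.mul_tempered (tempered_dP hK h.1.decays h.dressingExists)
  refine ⟨fun x k => (hasDerivAt_variation hK h hq a c x k).differentiableAt,
    fun x => ((tempered_potential hK h.1.decays h.dressingExists hq a c).polyGrowth
      x).1.measurable, fun x k => ?_, fun x k => ?_, fun x k => ?_, ?_⟩
  · refine (((hM x).integrable_mul (hθP.rapid x).integrable k).div_const (dP K (θ x) k)).congr
      (ae_of_all _ fun l => ?_)
    ring
  · rw [kint_alpha_variation h]
    exact (hM x).integrable_mul (hθG.rapid x).integrable k
  · rw [kint_alpha_variation h]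
    exact hasDerivAt_potential hK h hq a c x k
  · obtain ⟨C, hC⟩ := exists_integral_alpha_le hK h hq a c
    exact ⟨C, 0, fun x k => by simpa using hC x k⟩

lemma tendsto_potential {K θ : ℝ → ℝ → ℝ} {q : ℝ → ℝ} (hK : IsTBAKernel K)
    (h : IsPhasePoint K θ) (hq : PolyGrowth q) (a c k : ℝ) :
    Tendsto (fun x => potential K a c q θ x k) (cocompact ℝ) (𝓝 (a * q k)) := by
  obtain ⟨C, hC⟩ := exists_abs_kint_alpha_le hK h.1.decays h.dressingExists
    (decays_density h.1.decays hq a c)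
  have := (tendsto_zero_of_abs_le_inv_one_add_sq fun x => hC x k).add_const (a * q k)
  rwa [zero_add] at this

lemma energy_generates {K : ℝ → ℝ → ℝ} {q : ℝ → ℝ} (hK : IsTBAKernel K) (hq : PolyGrowth q)
    (a c : ℝ) : Generates K (fun k => a * q k) (energy K a c q)
      (fun θ x k => dx θ x k / dP K (θ x) k * (2 * c * dress K (θ x) q k)) := by
  intro θ h
  refine ⟨variation K a c q θ, potential K a c q θ,
    energy_hasFunctionalDeriv hK h.1.decays h.dressingExists hq a c,
    isDetermination_potential hK h hq a c, tendsto_potential hK h hq a c, fun x k => ?_⟩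
  have := bracketField_variation (b := fun _ => 0) hK h hq a c x k (by simp)
  simpa [kint] using this

/-! ### Brackets of two functionals -/

/-- Differentiating `U r` produces `α θₓ U r`. Symmetry shifts `α` onto the density, where it
supplies the non-local part of `G`, so the integrand of the bracket is a total `x`-derivative. -/
lemma hasDerivAt_integral_density {K θ : ℝ → ℝ → ℝ} {q r : ℝ → ℝ} (hK : IsTBAKernel K)
    (h : IsPhasePoint K θ) (hq : PolyGrowth q) (hr : PolyGrowth r) (a c x : ℝ) :
    HasDerivAt (fun x => ∫ k, density a c q θ x k * dress K (θ x) r k)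
      (∫ k, dx θ x k * (reducedVar K a c q θ x k * dress K (θ x) r k)) x := by
  have hθ := h.1.decays
  have hU := h.dressingExists
  have hd := decays_density hθ hq a c
  have hd' := decays_density_deriv h.1 hq a c
  have hr' := tempered_dress hK hθ hU hr
  have hθr := h.1.decays_dx.mul_tempered hr'
  have hk := tempered_kint_alpha hK hθ hU hθr
  have hF' := (hd'.mul_tempered hr').add (hd.mul_tempered hk)
  obtain ⟨B, hB⟩ := hF'.exists_abs_le_right
  refine (hasDerivAt_integral_of_dominated_loc_of_deriv_le (s := Set.univ) (μ := volume)
    (F := fun x k => density a c q θ x k * dress K (θ x) r k) (x₀ := x)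
    (bound := fun l => B * (1 + l ^ 2)⁻¹)
    (F' := fun x k => dx θ x k * ((a + 2 * c * θ x k) * q k) * dress K (θ x) r k +
      density a c q θ x k * kint (alpha K (θ x)) (fun l => dx θ x l * dress K (θ x) r l) k)
    univ_mem (Eventually.of_forall fun y => ((hd.mul_tempered hr').rapid y).integrable.1)
    ((hd.mul_tempered hr').rapid x).integrable (hF'.rapid x).integrable.1
    (ae_of_all _ fun l y _ => hB y l) (integrable_inv_one_add_sq.const_mul B)
    (ae_of_all _ fun l y _ => (hasDerivAt_density h.1 q a c y l).mul
      (hasDerivAt_dress_phase hK h hr y l))).2.congr_deriv ?_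
  rw [integral_add ((hd'.mul_tempered hr').rapid x).integrable
      ((hd.mul_tempered hk).rapid x).integrable,
    integral_mul_kint_alpha hK (hθ.rapid x) (hU x) (hd.rapid x).integrable
      (hθr.rapid x).integrable,
    ← integral_add ((hd'.mul_tempered hr').rapid x).integrable
      ((hθr.mul_tempered (tempered_kint_alpha hK hθ hU hd)).rapid x).integrable]
  congr 1; ext k
  simp only [reducedVar, potential]
  ring

lemma integral_eq_zero_of_tendsto_cocompact {u u' : ℝ → ℝ} {b : ℝ}
    (hd : ∀ x, HasDerivAt u (u' x) x) (hi : Integrable u')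
    (hl : Tendsto u (cocompact ℝ) (𝓝 b)) : ∫ x, u' x = 0 := by
  rw [integral_of_hasDerivAt_of_tendsto hd hi (hl.mono_left atBot_le_cocompact)
    (hl.mono_left atTop_le_cocompact), sub_self]

lemma integral_reducedVar_dress_eq_zero {K θ : ℝ → ℝ → ℝ} {q r : ℝ → ℝ} (hK : IsTBAKernel K)
    (h : IsPhasePoint K θ) (hq : PolyGrowth q) (hr : PolyGrowth r) (a c : ℝ) :
    ∫ p : ℝ × ℝ, dx θ p.1 p.2 * (reducedVar K a c q θ p.1 p.2 * dress K (θ p.1) r p.2) = 0 := by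
  have hG := h.1.decays_dx.mul_tempered ((tempered_reducedVar hK h.1.decays h.dressingExists
    hq a c).mul (tempered_dress hK h.1.decays h.dressingExists hr))
  have hd := (decays_density h.1.decays hq a c).mul_tempered
    (tempered_dress hK h.1.decays h.dressingExists hr)
  rw [hG.integral_prod_eq]
  refine integral_eq_zero_of_tendsto_cocompact (b := 0)
    (hasDerivAt_integral_density hK h hq hr a c) hG.integrable_integral ?_
  obtain ⟨C, hC⟩ := hd.exists_integral_abs_le
  exact tendsto_zero_of_abs_le_inv_one_add_sq fun x =>
    (abs_integral_le_integral_abs).trans (hC x)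

/-- The constants of integration do not contribute to the bracket of two functionals. -/
lemma integral_reducedVar_kint_eq_zero {K θ : ℝ → ℝ → ℝ} {q b : ℝ → ℝ} (hK : IsTBAKernel K)
    (h : IsPhasePoint K θ) (hq : PolyGrowth q) (a c : ℝ) (hbm : Measurable b) {C : ℝ} {N : ℕ}
    (hbi : ∀ x k, Integrable fun l => alpha K (θ x) k l * b l)
    (hbC : ∀ x k, ∫ l, |alpha K (θ x) k l * b l| ≤ C * (1 + |k|) ^ N) :
    Integrable (fun p : ℝ × ℝ => dx θ p.1 p.2 * reducedVar K a c q θ p.1 p.2 *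
      kint (alpha K (θ p.1)) b p.2) ∧
    ∫ p : ℝ × ℝ, dx θ p.1 p.2 * reducedVar K a c q θ p.1 p.2 *
      kint (alpha K (θ p.1)) b p.2 = 0 := by
  have hG := h.1.decays_dx.mul_tempered (tempered_reducedVar hK h.1.decays h.dressingExists hq a c)
  have hCt : PolyGrowth fun k => C * (1 + |k|) ^ N :=
    ⟨by fun_prop, |C|, N, fun k => by
      rw [abs_mul, abs_of_nonneg (show 0 ≤ (1 + |k|) ^ N by positivity)]⟩
  -- Nothing is known of `b` beyond measurability and the bounds on `α b`. The polynomial growth of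
  -- these in `k` is absorbed by the rapid decay of `θₓ G`.
  have hi : Integrable (fun z : (ℝ × ℝ) × ℝ => dx θ z.1.1 z.1.2 *
      reducedVar K a c q θ z.1.1 z.1.2 * (alpha K (θ z.1.1) z.1.2 z.2 * b z.2))
      ((volume : Measure (ℝ × ℝ)).prod volume) := by
    have hm : AEStronglyMeasurable (fun z : (ℝ × ℝ) × ℝ => dx θ z.1.1 z.1.2 *
      reducedVar K a c q θ z.1.1 z.1.2 * (alpha K (θ z.1.1) z.1.2 z.2 * b z.2))
      ((volume : Measure (ℝ × ℝ)).prod volume) := by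
      refine Measurable.aestronglyMeasurable ?_
      refine (hG.continuous.comp continuous_fst).measurable.mul
        (Continuous.measurable ?_ |>.mul (hbm.comp measurable_snd))
      exact (continuous_alpha hK h.1.decays h.dressingExists).comp
        ((continuous_fst.comp continuous_fst).prodMk
          ((continuous_snd.comp continuous_fst).prodMk continuous_snd))
    refine (integrable_prod_iff hm).2 ⟨ae_of_all _ fun p => ?_, ?_⟩
    · exact (hbi p.1 p.2).const_mul (dx θ p.1 p.2 * reducedVar K a c q θ p.1 p.2)
    refine (hG.mul_tempered hCt.tempered).integrable_prod.norm.mono'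
      hm.norm.integral_prod_right' (ae_of_all _ fun p => ?_)
    simp only [norm_mul, Real.norm_eq_abs, integral_const_mul]
    rw [abs_abs, abs_abs, ← abs_mul C]
    have h1 := hbC p.1 p.2
    simp only [abs_mul] at h1
    rw [abs_of_nonneg (show 0 ≤ ∫ l, |alpha K (θ p.1) p.2 l| * |b l| by positivity),
      abs_of_nonneg (le_trans (by positivity) h1)]
    gcongr
  have hi2 := hi.integral_prod_left
  simp only [integral_const_mul] at hi2
  refine ⟨hi2, ?_⟩
  have hα : ∀ l, Tempered fun x k => alpha K (θ x) k l := fun l => by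
    obtain ⟨M, -, hM⟩ := exists_uniform_bound_alpha hK h.1.decays h.dressingExists
    exact ⟨(continuous_alpha hK h.1.decays h.dressingExists).comp
      (continuous_fst.prodMk (continuous_snd.prodMk continuous_const)), M, 0,
      fun x k => by simpa using (hM x).bound k l⟩
  -- For fixed `l`, symmetry of `α` turns the `k`-integral into `(α θₓ G)(l) = ∂ₓ F(x,l)`, and
  -- `F(·,l)` has the same limit `a q(l)` at both ends.
  have hz : ∀ l, ∫ p : ℝ × ℝ, dx θ p.1 p.2 * reducedVar K a c q θ p.1 p.2 *
      alpha K (θ p.1) p.2 l = 0 := fun l => by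
    have hGα := hG.mul_tempered (hα l)
    have e : ∀ x, ∫ k, dx θ x k * reducedVar K a c q θ x k * alpha K (θ x) k l =
        kint (alpha K (θ x)) (fun k => dx θ x k * reducedVar K a c q θ x k) l := fun x => by
      rw [kint]
      congr 1; ext k
      rw [alpha_symm hK (h.1.decays.rapid x) (h.dressingExists x) l k]; ring
    have hGi := hGα.integrable_integral
    rw [hGα.integral_prod_eq]
    simp only [e] at hGi ⊢
    exact integral_eq_zero_of_tendsto_cocompact (fun x => hasDerivAt_potential hK h hq a c x l)
      hGi (tendsto_potential hK h hq a c l)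
  simp only [kint, ← integral_const_mul]
  rw [integral_integral_swap (f := fun (p : ℝ × ℝ) l => dx θ p.1 p.2 *
    reducedVar K a c q θ p.1 p.2 * (alpha K (θ p.1) p.2 l * b l)) hi]
  simp only [← mul_assoc, integral_mul_const, hz, zero_mul, integral_zero]

lemma energy_hasBracket {K θ : ℝ → ℝ → ℝ} {q r : ℝ → ℝ} (hK : IsTBAKernel K)
    (h : IsPhasePoint K θ) (hq : PolyGrowth q) (hr : PolyGrowth r) (a c a' c' : ℝ) :
    HasBracket K (energy K a c q) (energy K a' c' r) θ 0 := by
  have hI := energy_hasFunctionalDeriv hK h.1.decays h.dressingExists hq a c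
  have hJ := energy_hasFunctionalDeriv hK h.1.decays h.dressingExists hr a' c'
  refine ⟨⟨_, _, _, hI, hJ, isDetermination_potential hK h hr a' c'⟩, ?_⟩
  intro DI DJ F hDI hDJ hF
  obtain rfl := hDI.unique hI
  obtain rfl := hDJ.unique hJ
  -- Both determinations have the same `x`-derivative, so their difference is constant in `x` and
  -- may be read off at `x = 0`.
  set b : ℝ → ℝ := fun k => F 0 k - potential K a' c' r θ 0 k with hb
  have hFb : F = fun x k => potential K a' c' r θ x k + b k := by
    ext x k
    have hder : ∀ x, HasDerivAt (fun x => F x k - potential K a' c' r θ x k) 0 x := fun x => by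
      have h1 := hF.hasDerivAt x k
      rw [kint_alpha_variation h] at h1
      exact (h1.sub (hasDerivAt_potential hK h hr a' c' x k)).congr_deriv (sub_self _)
    have := is_const_of_deriv_eq_zero (fun x => (hder x).differentiableAt)
      (fun x => (hder x).deriv) x 0
    simp only [hb]
    linarith
  have hbm : Measurable b := (hF.measurable 0).sub
    ((tempered_potential hK h.1.decays h.dressingExists hr a' c').polyGrowth 0).1.measurable
  obtain ⟨C, N, hC⟩ := hF.convergent
  obtain ⟨C', hC'⟩ := exists_integral_alpha_le hK h hr a' c'
  have hC'0 : 0 ≤ C' := (by positivity : (0 : ℝ) ≤ _).trans (hC' 0 0).2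
  -- The convergence condition holds for `F` by assumption and for `potential` by computation;
  -- subtracting the two gives the bounds on `α b`.
  have eb : ∀ x k l, alpha K (θ x) k l * b l =
      alpha K (θ x) k l *
        (variation K a' c' r θ x l / dP K (θ x) l - potential K a' c' r θ x l) -
      alpha K (θ x) k l * (variation K a' c' r θ x l / dP K (θ x) l - F x l) := fun x k l => by
    rw [hFb]; ring
  have hbi : ∀ x k, Integrable fun l => alpha K (θ x) k l * b l := fun x k => by
    simp only [eb]
    exact (hC' x k).1.sub (hC x k).1
  have hbC : ∀ x k, ∫ l, |alpha K (θ x) k l * b l| ≤ (C + C') * (1 + |k|) ^ N := fun x k => by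
    have h1 := one_le_one_add_abs_pow k N
    calc _ ≤ ∫ l, (|alpha K (θ x) k l *
          (variation K a' c' r θ x l / dP K (θ x) l - potential K a' c' r θ x l)| +
          |alpha K (θ x) k l * (variation K a' c' r θ x l / dP K (θ x) l - F x l)|) := by
          refine integral_mono (hbi x k).abs ((hC' x k).1.abs.add (hC x k).1.abs) fun l => ?_
          simp only [eb]
          exact abs_sub _ _
      _ ≤ C' + C * (1 + |k|) ^ N := by
          rw [integral_add (hC' x k).1.abs (hC x k).1.abs]
          exact add_le_add (hC' x k).2 (hC x k).2
      _ ≤ _ := by nlinarith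
  obtain ⟨hi, hz⟩ := integral_reducedVar_kint_eq_zero hK h hq a c hbm hbi hbC
  have hG := (h.1.decays_dx.mul_tempered ((tempered_reducedVar hK h.1.decays h.dressingExists
    hq a c).mul (tempered_dress hK h.1.decays h.dressingExists hr))).integrable_prod
  have e : (fun p : ℝ × ℝ => variation K a c q θ p.1 p.2 *
      bracketField K θ (variation K a' c' r θ) F p.1 p.2) = fun p =>
      2 * c' * (dx θ p.1 p.2 * (reducedVar K a c q θ p.1 p.2 * dress K (θ p.1) r p.2)) -
      dx θ p.1 p.2 * reducedVar K a c q θ p.1 p.2 * kint (alpha K (θ p.1)) b p.2 := by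
    ext p
    rw [hFb, bracketField_variation hK h hr a' c' p.1 p.2 (hbi p.1 p.2)]
    have h1 := h.dP_ne_zero p.1 p.2
    simp only [variation]
    field_simp
  rw [e]
  refine ⟨(hG.const_mul _).sub hi, ?_⟩
  rw [integral_sub (hG.const_mul _) hi, integral_const_mul,
    integral_reducedVar_dress_eq_zero hK h hq hr a c, hz]
  simp

/-! ### Commuting flows -/

lemma polyGrowth_pow (n : ℕ) : PolyGrowth (fun k => k ^ n) :=
  ⟨by fun_prop, 1, n, fun k => by
    rw [abs_pow, one_mul]
    exact pow_le_pow_left₀ (abs_nonneg k) (by linarith) n⟩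

lemma polyGrowth_charge (n : ℕ) : PolyGrowth (charge n) := by
  by_cases hn : n = 0
  · have : charge n = fun _ => 1 := by ext k; simp [charge, hn]
    rw [this]; exact PolyGrowth.const 1
  · have : charge n = fun k => k ^ n * (1 / n : ℝ) := by
      ext k; simp [charge, hn, div_eq_mul_inv]
    rw [this]; exact (polyGrowth_pow n).mul (PolyGrowth.const _)

lemma deriv_charge_succ (n : ℕ) : deriv (charge (n + 1)) = fun k => k ^ n := by
  ext k
  have : charge (n + 1) = fun k => k ^ (n + 1) / ((n + 1 : ℕ) : ℝ) := by
    ext k; simp [charge]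
  rw [this, ((hasDerivAt_pow (n + 1) k).div_const _).deriv]
  have : ((n + 1 : ℕ) : ℝ) ≠ 0 := by positivity
  field_simp
  simp

lemma polyGrowth_deriv_charge (n : ℕ) : PolyGrowth (deriv (charge (n + 1))) := by
  rw [deriv_charge_succ]; exact polyGrowth_pow n

/-- The derivative of the vector field `-(U q / P') θₓ` along `-(U r / P') θₓ`. -/
lemma hasDerivAt_flow {K θ : ℝ → ℝ → ℝ} {q r : ℝ → ℝ} (hK : IsTBAKernel K)
    (h : IsPhasePoint K θ) (hq : PolyGrowth q) (hr : PolyGrowth r) (x k : ℝ) :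
    let Y : ℝ → ℝ → ℝ := fun x k => -(dress K (θ x) r k / dP K (θ x) k * dx θ x k)
    HasDerivAt (fun ε : ℝ => -(dress K (fun l => θ x l + ε * Y x l) q k /
        dP K (fun l => θ x l + ε * Y x l) k * dx (fun y l => θ y l + ε * Y y l) x k))
      (kint (alpha K (θ x)) (fun l => dx θ x l *
          (dress K (θ x) q l * dress K (θ x) r l) / dP K (θ x) l) k * dx θ x k / dP K (θ x) k -
        dress K (θ x) q k * dress K (θ x) r k *
          kint (alpha K (θ x)) (fun l => dx θ x l * dP K (θ x) l) k * dx θ x k /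
            dP K (θ x) k ^ 3 +
        dress K (θ x) q k * dress K (θ x) r k * dx (dx θ) x k / dP K (θ x) k ^ 2) 0 := by
  intro Y
  have hP := h.dP_ne_zero x
  have hU := h.dressingExists x
  have hrap := h.1.decays.rapid x
  have h1g : PolyGrowth (fun _ : ℝ => (1 : ℝ)) := PolyGrowth.const 1
  -- Only the slice at `x` must decay rapidly. The lower bound on `P'` may depend on `x`, and the
  -- displaced field need not be a phase point.
  have hY : Rapid (Y x) := by
    have hinv : PolyGrowth fun l => (dP K (θ x) l)⁻¹ := by
      obtain ⟨δ, hδ, hle⟩ := (h.2 x).2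
      refine polyGrowth_of_bounded ((polyGrowth_dress hU h1g).1.inv₀ hP) (C := δ⁻¹) fun l => ?_
      rw [abs_inv]
      exact inv_anti₀ hδ ((hle l).trans (le_abs_self _))
    have e : Y x = fun l => -1 * (dx θ x l * (dress K (θ x) r l * (dP K (θ x) l)⁻¹)) := by
      ext l; simp only [Y]; ring
    rw [e]
    exact ((h.1.decays_dx.rapid x).mul_poly ((polyGrowth_dress hU hr).mul hinv)).const_mul (-1)
  have hdress : ∀ f : ℝ → ℝ, PolyGrowth f →
      HasDerivAt (fun ε : ℝ => dress K (fun l => θ x l + ε * Y x l) f k)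
        (kint (alpha K (θ x)) (fun l => Y x l * dress K (θ x) f l) k) 0 := fun f hf => by
    have h0 : (fun l => θ x l + 0 * Y x l) = θ x := by ext; simp
    have := hasDerivAt_dress (s := fun ε l => θ x l + ε * Y x l) (s' := fun _ => Y x) (t₀ := 0) hK
      (fun ε => hrap.add (hY.const_mul ε))
      (fun ε l => by simpa using ((hasDerivAt_id ε).mul_const (Y x l)).const_add (θ x l))
      (fun N => (hY.2 N).imp fun C hC _ => hC) hY.1 (by rw [h0]; exact hU) hf k
    simpa only [h0] using this
  obtain ⟨Y', hY', hYx⟩ : ∃ Y' : ℝ, Y' =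
      -((kint (alpha K (θ x)) (fun l => dx θ x l * dress K (θ x) r l) k * dP K (θ x) k -
        dress K (θ x) r k * kint (alpha K (θ x)) (fun l => dx θ x l * dP K (θ x) l) k) /
          dP K (θ x) k ^ 2 * dx θ x k + dress K (θ x) r k / dP K (θ x) k * dx (dx θ) x k) ∧ HasDerivAt (fun y => Y y k) Y' x :=
    ⟨_, rfl, (((hasDerivAt_dress_phase hK h hr x k).div (hasDerivAt_dress_phase hK h h1g x k) (hP k)).mul
      (h.1.hasDerivAt_dx x k)).neg⟩
  have hdx : ∀ ε : ℝ, dx (fun y l => θ y l + ε * Y y l) x k = dx θ x k + ε * Y' := fun ε =>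
    ((h.1.hasDerivAt x k).add (hYx.const_mul ε)).deriv
  simp only [hdx]
  have e0 : (fun l => θ x l + 0 * Y x l) = θ x := by ext; simp
  have hden : dress K (fun l => θ x l + 0 * Y x l) (fun _ => 1) k ≠ 0 := by
    rw [e0]; exact hP k
  -- The variation of `P'` along `Y` is `-α θₓ U r`. Its contribution cancels the term with `α θₓ U
  -- r` in `∂ₓ Y`, the only one not symmetric in `q` and `r`.
  have key := (((hdress q hq).div (hdress _ h1g) hden).mul
    (((hasDerivAt_id (0 : ℝ)).mul_const Y').const_add (dx θ x k))).neg
  refine key.congr_deriv ?_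
  have e1 : kint (alpha K (θ x)) (fun l => Y x l * dress K (θ x) q l) k =
      -1 * kint (alpha K (θ x)) (fun l => dx θ x l *
          (dress K (θ x) q l * dress K (θ x) r l) / dP K (θ x) l) k := by
    rw [← kint_const_mul]
    congr 1; ext l; simp only [Y]; ring
  have e2 : kint (alpha K (θ x)) (fun l => Y x l * dress K (θ x) (fun _ => 1) l) k =
      -1 * kint (alpha K (θ x)) (fun l => dx θ x l * dress K (θ x) r l) k := by
    rw [← kint_const_mul]
    congr 1; ext l
    have h2 := hP l
    simp only [Y]
    change -(dress K (θ x) r l / dP K (θ x) l * dx θ x l) * dP K (θ x) l = _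
    field_simp
  have h3 := hP k
  have e3 : dress K (θ x) (fun _ => 1) = dP K (θ x) := rfl
  simp only [Pi.div_apply, e0, e1, e2, id, hY']
  rw [e3]
  field_simp
  ring

lemma commuteAt_flow {K θ : ℝ → ℝ → ℝ} (hK : IsTBAKernel K) (h : IsPhasePoint K θ) (m n : ℕ) :
    CommuteAt (flow K m) (flow K n) θ := by
  intro x k
  have h1 := hasDerivAt_flow hK h (polyGrowth_deriv_charge m) (polyGrowth_deriv_charge n) x k
  have h2 := hasDerivAt_flow hK h (polyGrowth_deriv_charge n) (polyGrowth_deriv_charge m) x k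
  refine ⟨_, h1, h2.congr_deriv ?_⟩
  simp only [mul_comm (dress K (θ x) (deriv (charge (n + 1))) _)]

/-! ### The charges and Hamiltonians -/

lemma casimirQ_eq_energy (K : ℝ → ℝ → ℝ) (n : ℕ) :
    casimirQ K n = energy K (1 / (2 * Real.pi)) 0 (charge n) := by
  ext θ
  simp only [casimirQ, energy, rho, density]
  congr 1; ext x; congr 1; ext k; ring

lemma hamiltonianH_eq_energy (K : ℝ → ℝ → ℝ) (n : ℕ) :
    hamiltonianH K n = energy K 0 (-(1 / 2)) (deriv (charge (n + 1))) := by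
  ext θ
  simp only [hamiltonianH, energy, rho, density, ← integral_const_mul]
  congr 1; ext x; congr 1; ext k
  field_simp
  ring

lemma isCasimir_casimirQ {K : ℝ → ℝ → ℝ} (hK : IsTBAKernel K) (n : ℕ) :
    IsCasimir K (casimirQ K n) := by
  have h := energy_generates hK (polyGrowth_charge n) (1 / (2 * Real.pi)) 0
  simp only [mul_zero, zero_mul] at h
  rw [casimirQ_eq_energy]
  exact ⟨_, h⟩

lemma hamiltonianH_generates_flow {K : ℝ → ℝ → ℝ} (hK : IsTBAKernel K) (n : ℕ) :
    Generates K (fun _ => 0) (hamiltonianH K n) (flow K n) := by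
  have h := energy_generates hK (polyGrowth_deriv_charge n) 0 (-(1 / 2))
  have e : flow K n = fun θ x k => dx θ x k / dP K (θ x) k *
      (2 * -(1 / 2) * dress K (θ x) (deriv (charge (n + 1))) k) := by
    ext θ x k
    simp only [flow, velocity, dQ]
    ring
  simp only [zero_mul] at h
  rwa [hamiltonianH_eq_energy, e]

end BetheBoltzmann

end

/-! ### The main theorem, from the common functional `energy`. -/

theorem mainTheorem12 (K : ℝ → ℝ → ℝ) (hK : BetheBoltzmann.IsTBAKernel K) :
    (∀ n : ℕ, BetheBoltzmann.IsCasimir K (BetheBoltzmann.casimirQ K n)) ∧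
    ((∀ n : ℕ, BetheBoltzmann.Generates K (fun _ => 0)
        (BetheBoltzmann.hamiltonianH K n) (BetheBoltzmann.flow K n)) ∧
      ∀ (m n : ℕ) (θ : ℝ → ℝ → ℝ), BetheBoltzmann.IsPhasePoint K θ →
        BetheBoltzmann.CommuteAt (BetheBoltzmann.flow K m) (BetheBoltzmann.flow K n) θ) ∧
    ∀ (m n : ℕ) (θ : ℝ → ℝ → ℝ), BetheBoltzmann.IsPhasePoint K θ →
      BetheBoltzmann.HasBracket K (BetheBoltzmann.casimirQ K m)
        (BetheBoltzmann.casimirQ K n) θ 0 ∧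
      BetheBoltzmann.HasBracket K (BetheBoltzmann.hamiltonianH K m)
        (BetheBoltzmann.casimirQ K n) θ 0 ∧
      BetheBoltzmann.HasBracket K (BetheBoltzmann.casimirQ K n)
        (BetheBoltzmann.hamiltonianH K m) θ 0 ∧
      BetheBoltzmann.HasBracket K (BetheBoltzmann.hamiltonianH K m)
        (BetheBoltzmann.hamiltonianH K n) θ 0 := by
  open BetheBoltzmann in
  have hc := polyGrowth_charge
  have hd := polyGrowth_deriv_charge
  refine ⟨isCasimir_casimirQ hK, ⟨hamiltonianH_generates_flow hK,
    fun m n θ h => commuteAt_flow hK h m n⟩, fun m n θ h => ?_⟩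
  simp only [casimirQ_eq_energy, hamiltonianH_eq_energy]
  exact ⟨energy_hasBracket hK h (hc m) (hc n) _ _ _ _,
    energy_hasBracket hK h (hd m) (hc n) _ _ _ _,
    energy_hasBracket hK h (hc n) (hd m) _ _ _ _,
    energy_hasBracket hK h (hd m) (hd n) _ _ _ _⟩
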